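/- **Corollary 3.1.** Let $n\ge 1$ and let $\Phi:(0,\infty)\to(0,\infty)$ be non-increasing and continuous and such that, for some constants $C,C'>0$ and all $r>0$, $$\int_0^r\Phi(\rho)\rho^{n-1}\,d\rho\le C\,\Phi(r)r^n\quad(\Phi\in B_n(\infty)),\qquad \int_0^{r^n}\frac{ds}{\Phi(s^{1/n})\,s}\le\frac{C'}{\Phi(r)}\quad(\Phi\in D(\infty)).$$ Let $E=E(\mathbb R^n)$ be a rearrangement-invariant space, i.e. the space of measurable $f:\mathbb R^n\to\mathbb C$ with $\|f\|_E=\rho(|f|)<\infty$, where $\rho$ is a Banach function norm on the non-negative Lebesgue measurable functions (a definite, positively homogeneous, subadditive, monotone functional with the Fatou property, with $\int_\sigma f\,dx\le c_\sigma\rho(f)$ and $\rho(\chi_\sigma)<\infty$ whenever $0<|\sigma|<\infty$) such that $f^*\le g^*$ implies $\rho(f)\le\rho(g)$. Here, for a measurable function $u$, $$u^*(t)=\inf\{y>0:\ |\{x:|u(x)|>y\}|\le t\},\qquad u^{**}(t)=\frac1t\int_0^tu^*(\tau)\,d\tau\qquad(t>0).$$ For $f\in E$ put $(M_\Phi f)(x)=\sup_{r>0}\Phi(r)\int_{B(x,r)}|f(y)|\,dy$,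 and let $M_E^\Phi=\{M_\Phi f: f\in E\}$ with $\|u\|_{M_E^\Phi}=\inf\{\|f\|_E: f\in E,\ M_\Phi f=u\}$. Maximal functions, rearrangements and suprema take values in $[0,\infty]$. Consider the following four cones of measurable functions $h:(0,\infty)\to[0,\infty]$, each with its functional: * $K_1=\{u^*: u\in M_E^\Phi\}$, $\ \rho_{K_1}(h)=\inf\{\|u\|_{M_E^\Phi}: u\in M_E^\Phi,\ u^*=h\}$; * $K_2=\{u^{**}: u\in M_E^\Phi\}$, $\ \rho_{K_2}(h)=\inf\{\|u\|_{M_E^\Phi}: u\in M_E^\Phi,\ u^{**}=h\}$; * $K_3=\{A f: f\in E\}$, $\ \rho_{K_3}(h)=\inf\{\|f\|_E: f\in E,\ Af=h\}$, where $(Af)(t)=\sup_{t<\tau<\infty}\tau\Phi(\tau^{1/n})f^{**}(\tau)$; * $K_4=\{B f: f\in E\}$, $\ \rho_{K_4}(h)=\inf\{\|f\|_E: f\in E,\ Bf=h\}$, where $(Bf)(t)=t\Phi(t^{1/n})f^{**}(t)+\sup_{t<\tau<\infty}\tau\Phi(\tau^{1/n})f^{*}(\tau)$. Write $M\prec K$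 ($K$ covers $M$) if there is a constant $C_0\in(0,\infty)$ such that for every $h_1\in M$ there is $h_2\in K$ with $\rho_K(h_2)\le C_0\,\rho_M(h_1)$ and $h_1(t)\le h_2(t)$ for all $t>0$; write $M\approx K$ if $M\prec K$ and $K\prec M$. Then $$K_1\approx K_2\approx K_3\approx K_4 .$$ -/

import Mathlib

open MeasureTheory Set Filter Topology
open scoped NNReal ENNReal

namespace FracMax

noncomputable section

/-! ### Functional norms and rearrangement-invariant spaces -/

/-- The distribution function `λ_u(y) = μ {x : u x > y}` of a `[0,∞]`-valued function. -/
def distribution {α : Type*} [MeasurableSpace α] (μ : Measure α) (u : α → ℝ≥0∞) (y : ℝ≥0∞) :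
    ℝ≥0∞ :=
  μ {x | y < u x}

/-- The non-increasing rearrangement `u*(t) = inf {y > 0 : λ_u(y) ≤ t}` (with `inf ∅ = ∞`);
it is only used for `t > 0`. -/
def rearrangement {α : Type*} [MeasurableSpace α] (μ : Measure α) (u : α → ℝ≥0∞) (t : ℝ) : ℝ≥0∞ :=
  ⨅ (y : ℝ≥0) (_ : 0 < y ∧ distribution μ u y ≤ ENNReal.ofReal t), (y : ℝ≥0∞)

/-- The maximal rearrangement `u**(t) = t⁻¹ ∫₀ᵗ u*(τ) dτ`, used for `t > 0`. -/
def rearrangement₂ {α : Type*} [MeasurableSpace α] (μ : Measure α) (u : α → ℝ≥0∞) (t : ℝ) :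
    ℝ≥0∞ :=
  (ENNReal.ofReal t)⁻¹ * ∫⁻ τ in Ioo 0 t, rearrangement μ u τ

/-- A functional norm on the non-negative (a.e.-)measurable functions: axioms (P1)-(P5) of a
Banach function norm. The values on non-measurable functions play no role. -/
structure FunctionalNorm {α : Type*} [MeasurableSpace α] (μ : Measure α) where
  /-- the functional -/
  toFun : (α → ℝ≥0) → ℝ≥0∞
  /-- (P1), definiteness -/
  eq_zero_iff : ∀ f : α → ℝ≥0, AEMeasurable f μ → (toFun f = 0 ↔ f =ᵐ[μ] 0)
  /-- (P1), positive homogeneity -/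
  smul : ∀ (a : ℝ≥0) (f : α → ℝ≥0), AEMeasurable f μ → toFun (fun x => a * f x) = a * toFun f
  /-- (P1), triangle inequality -/
  add_le : ∀ f g : α → ℝ≥0, AEMeasurable f μ → AEMeasurable g μ →
    toFun (fun x => f x + g x) ≤ toFun f + toFun g
  /-- (P2), monotonicity -/
  mono : ∀ f g : α → ℝ≥0, AEMeasurable f μ → AEMeasurable g μ → f ≤ᵐ[μ] g → toFun f ≤ toFun g
  /-- (P3), the Fatou property -/
  fatou : ∀ (F : ℕ → α → ℝ≥0) (f : α → ℝ≥0), (∀ k, AEMeasurable (F k) μ) → AEMeasurable f μ →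
    (∀ᵐ x ∂μ, Monotone (fun k => F k x) ∧ Tendsto (fun k => F k x) atTop (𝓝 (f x))) →
    Tendsto (fun k => toFun (F k)) atTop (𝓝 (toFun f))
  /-- (P4), local integrability -/
  lintegral_le : ∀ s, MeasurableSet s → 0 < μ s → μ s < ∞ →
    ∃ c : ℝ≥0, ∀ f : α → ℝ≥0, AEMeasurable f μ → ∫⁻ x in s, (f x : ℝ≥0∞) ∂μ ≤ c * toFun f
  /-- (P5), characteristic functions of sets of finite measure have finite norm -/
  indicator_lt_top : ∀ s, MeasurableSet s → 0 < μ s → μ s < ∞ →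
    toFun (s.indicator fun _ => 1) < ∞

/-- `ρ` is rearrangement-invariant: `f* ≤ g*` on `(0,∞)` implies `ρ f ≤ ρ g`. -/
def FunctionalNorm.RearrangementInvariant {α : Type*} [MeasurableSpace α] {μ : Measure α}
    (ρ : FunctionalNorm μ) : Prop :=
  ∀ f g : α → ℝ≥0, AEMeasurable f μ → AEMeasurable g μ →
    (∀ t : ℝ, 0 < t →
      rearrangement μ (fun x => (f x : ℝ≥0∞)) t ≤ rearrangement μ (fun x => (g x : ℝ≥0∞)) t) →
    ρ.toFun f ≤ ρ.toFun g

/-- The norm `‖f‖_E = ρ(|f|)` of the function space `E = E(ρ)`. -/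
def FunctionalNorm.norm {α : Type*} [MeasurableSpace α] {μ : Measure α}
    (ρ : FunctionalNorm μ) (f : α → ℂ) : ℝ≥0∞ :=
  ρ.toFun fun x => ‖f x‖₊

/-- The function space `E = E(ρ)`: the measurable functions with `ρ(|f|) < ∞`. -/
def FunctionalNorm.space {α : Type*} [MeasurableSpace α] {μ : Measure α}
    (ρ : FunctionalNorm μ) : Set (α → ℂ) :=
  {f | AEMeasurable f μ ∧ ρ.norm f < ∞}

/-! ### The classes `B_n(∞)` and `D(∞)` -/

/-- The class `B_n(∞)`: positive, non-increasing, continuous functions on `(0,∞)` with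
`∫₀ʳ Φ(ρ) ρ^(n-1) dρ ≤ C Φ(r) rⁿ` for all `r > 0`. -/
structure ClassB (n : ℕ) (Φ : ℝ → ℝ) : Prop where
  pos : ∀ r, 0 < r → 0 < Φ r
  antitoneOn : AntitoneOn Φ (Ioi 0)
  continuousOn : ContinuousOn Φ (Ioi 0)
  integral_le : ∃ C : ℝ, 0 < C ∧ ∀ r : ℝ, 0 < r →
    ∫⁻ x in Ioo 0 r, ENNReal.ofReal (Φ x * x ^ (n - 1)) ≤ ENNReal.ofReal (C * (Φ r * r ^ n))

/-- The class `D(∞)`: positive functions on `(0,∞)` with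
`∫₀^(rⁿ) ds / (Φ(s^(1/n)) s) ≤ C / Φ(r)` for all `r > 0`. -/
structure ClassD (n : ℕ) (Φ : ℝ → ℝ) : Prop where
  pos : ∀ r, 0 < r → 0 < Φ r
  integral_le : ∃ C : ℝ, 0 < C ∧ ∀ r : ℝ, 0 < r →
    ∫⁻ s in Ioo 0 (r ^ n), ENNReal.ofReal (1 / (Φ (s ^ (1 / (n : ℝ))) * s)) ≤
      ENNReal.ofReal (C / Φ r)

/-! ### The generalized fractional maximal function -/

/-- `ℝⁿ` with its Euclidean norm and Lebesgue measure. -/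
abbrev Rn (n : ℕ) : Type := EuclideanSpace ℝ (Fin n)

/-- `(M_Φ f)(x) = sup_{r>0} Φ(r) ∫_{B(x,r)} |f(y)| dy`, with values in `[0,∞]`. -/
def maximal {n : ℕ} (Φ : ℝ → ℝ) (f : Rn n → ℂ) (x : Rn n) : ℝ≥0∞ :=
  ⨆ (r : ℝ) (_ : 0 < r), ENNReal.ofReal (Φ r) * ∫⁻ y in Metric.ball x r, ‖f y‖ₑ

/-- The space `M_E^Φ` of the functions `u = M_Φ f` with `f ∈ E`. -/
def maximalSpace {n : ℕ} (Φ : ℝ → ℝ) (E : FunctionalNorm (volume : Measure (Rn n))) :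
    Set (Rn n → ℝ≥0∞) :=
  {u | ∃ f ∈ E.space, maximal Φ f = u}

/-- `‖u‖_{M_E^Φ} = inf {‖f‖_E : f ∈ E, M_Φ f = u}`. -/
def maximalNorm {n : ℕ} (Φ : ℝ → ℝ) (E : FunctionalNorm (volume : Measure (Rn n)))
    (u : Rn n → ℝ≥0∞) : ℝ≥0∞ :=
  ⨅ (f : Rn n → ℂ) (_ : f ∈ E.space ∧ maximal Φ f = u), E.norm f

/-! ### Cones of functions on `(0,∞)` and their mutual covering -/

/-- The half-line `(0,∞)`. -/
abbrev Rpos : Type := Ioi (0 : ℝ)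

/-- A set of `[0,∞]`-valued functions on `(0,∞)` together with a functional on it. -/
structure Cone where
  /-- the functions of the cone -/
  carrier : Set (Rpos → ℝ≥0∞)
  /-- the functional; only its values on `carrier` matter -/
  gauge : (Rpos → ℝ≥0∞) → ℝ≥0∞

/-- `M.CoveredBy K`, written `M ≺ K`, for cones on `(0,T)` with `T = ∞`; the additive term
`C₁(T) ρ_M(h₁)` of the general definition is absent because `C₁(∞) = 0`. -/
def Cone.CoveredBy (M K : Cone) : Prop :=
  ∃ C₀ : ℝ≥0, 0 < C₀ ∧ ∀ h₁ ∈ M.carrier, ∃ h₂ ∈ K.carrier,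
    K.gauge h₂ ≤ C₀ * M.gauge h₁ ∧ ∀ t, h₁ t ≤ h₂ t

/-- `M ≈ K`: mutual covering. -/
def Cone.Equivalent (M K : Cone) : Prop :=
  M.CoveredBy K ∧ K.CoveredBy M

/-- `u*` as a function on `(0,∞)`. -/
def star {n : ℕ} (u : Rn n → ℝ≥0∞) : Rpos → ℝ≥0∞ :=
  fun t => rearrangement volume u t

/-- `u**` as a function on `(0,∞)`. -/
def starStar {n : ℕ} (u : Rn n → ℝ≥0∞) : Rpos → ℝ≥0∞ :=
  fun t => rearrangement₂ volume u t

/-- `t ↦ sup_{t<τ<∞} τ Φ(τ^(1/n)) f**(τ)`. -/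
def supStarStar {n : ℕ} (Φ : ℝ → ℝ) (f : Rn n → ℂ) : Rpos → ℝ≥0∞ :=
  fun t => ⨆ (τ : Rpos) (_ : t < τ),
    ENNReal.ofReal (τ * Φ ((τ : ℝ) ^ (1 / (n : ℝ)))) * starStar (fun x => ‖f x‖ₑ) τ

/-- `t ↦ t Φ(t^(1/n)) f**(t) + sup_{t<τ<∞} τ Φ(τ^(1/n)) f*(τ)`. -/
def starStarAddSupStar {n : ℕ} (Φ : ℝ → ℝ) (f : Rn n → ℂ) : Rpos → ℝ≥0∞ :=
  fun t => ENNReal.ofReal (t * Φ ((t : ℝ) ^ (1 / (n : ℝ)))) * starStar (fun x => ‖f x‖ₑ) t +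
    ⨆ (τ : Rpos) (_ : t < τ),
      ENNReal.ofReal (τ * Φ ((τ : ℝ) ^ (1 / (n : ℝ)))) * star (fun x => ‖f x‖ₑ) τ

/-- The cone `K₁` of the rearrangements `u*`, `u ∈ M_E^Φ`. -/
def K₁ {n : ℕ} (Φ : ℝ → ℝ) (E : FunctionalNorm (volume : Measure (Rn n))) : Cone where
  carrier := {h | Measurable h ∧ ∃ u ∈ maximalSpace Φ E, star u = h}
  gauge h := ⨅ (u : Rn n → ℝ≥0∞) (_ : u ∈ maximalSpace Φ E ∧ star u = h), maximalNorm Φ E u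

/-- The cone `K₂` of the functions `u**`, `u ∈ M_E^Φ`. -/
def K₂ {n : ℕ} (Φ : ℝ → ℝ) (E : FunctionalNorm (volume : Measure (Rn n))) : Cone where
  carrier := {h | ∃ u ∈ maximalSpace Φ E, starStar u = h}
  gauge h := ⨅ (u : Rn n → ℝ≥0∞) (_ : u ∈ maximalSpace Φ E ∧ starStar u = h), maximalNorm Φ E u

/-- The cone `K₃` of the functions `sup_{t<τ<∞} τ Φ(τ^(1/n)) f**(τ)`, `f ∈ E`. -/
def K₃ {n : ℕ} (Φ : ℝ → ℝ) (E : FunctionalNorm (volume : Measure (Rn n))) : Cone where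
  carrier := {h | Measurable h ∧ ∃ f ∈ E.space, supStarStar Φ f = h}
  gauge h := ⨅ (f : Rn n → ℂ) (_ : f ∈ E.space ∧ supStarStar Φ f = h), E.norm f

/-- The cone `K₄` of the functions `t Φ(t^(1/n)) f**(t) + sup_{t<τ<∞} τ Φ(τ^(1/n)) f*(τ)`,
`f ∈ E`. -/
def K₄ {n : ℕ} (Φ : ℝ → ℝ) (E : FunctionalNorm (volume : Measure (Rn n))) : Cone where
  carrier := {h | Measurable h ∧ ∃ f ∈ E.space, starStarAddSupStar Φ f = h}
  gauge h := ⨅ (f : Rn n → ℂ) (_ : f ∈ E.space ∧ starStarAddSupStar Φ f = h), E.norm f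

end

end FracMax

/-! Each cone is the image of `E` under an operator `T`, with the quotient functional of the norm,
so coverings reduce to pointwise comparison of operators. The hub is `A = supStarStar Φ`, rewritten
as `A f (t) = sup_{τ>t} Φ(τ^(1/n)) ∫₀^τ f*`. For each of the four operators, `T f ≤ C · A f`, and `A
f ≤ C · T g` for some `g` with `‖g‖ ≤ ‖f‖`; any two operators are then comparable through `A`.

The upper bound for `(M_Φ f)**` (`ClassB.exists_starStar_maximal_le`) cuts `f` at height `f*(t)` and
balls at radius `t^(1/n)`. Small balls acting on the high part are dominated by convolution with the
integrable kernel `Φ(|x|)` on `|x| < t^(1/n)`; everything else is bounded by a multiple of `A f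
(t)`. The lower bound for `(M_Φ g)*` (`exists_supStarStar_le_star`) takes `g` to be the radial
rearrangement of `f`, which has no larger norm by rearrangement invariance. The comparison of `A`
with `B` is the only place where `D(∞)` enters.

The infima defining the functionals need not be attained. A near-minimiser suffices when the infimum
is positive. If it vanishes at a nonzero function, summing large multiples of small preimages gives
`g ∈ E` with `A g ≡ ∞`, so the target cone contains the constant `∞` with functional zero. -/

namespace FracMax

/-! ### Distribution functions and rearrangements -/

section Rearrangement

variable {α : Type*} [MeasurableSpace α] {μ : Measure α}

lemma distribution_antitone (u : α → ℝ≥0∞) : Antitone (distribution μ u) :=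
  fun _ _ h => measure_mono fun _ hx => lt_of_le_of_lt h hx

lemma distribution_mono {u v : α → ℝ≥0∞} (h : u ≤ᵐ[μ] v) (y : ℝ≥0∞) :
    distribution μ u y ≤ distribution μ v y :=
  measure_mono_ae (h.mono fun _ hx hy => lt_of_lt_of_le hy hx)

/-- Right-continuity of the distribution function, by continuity of the measure along the increasing
sets `{z k < u}` as `z k ↓ y`. -/
lemma exists_distribution_gt {u : α → ℝ≥0∞} {y c : ℝ≥0∞} (h : c < distribution μ u y) :
    ∃ z, y < z ∧ c < distribution μ u z := by
  have hy : y < ∞ := by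
    rw [lt_top_iff_ne_top]
    rintro rfl
    simp [distribution] at h
  obtain ⟨z, hz, hz', hlim⟩ := exists_seq_strictAnti_tendsto' hy
  have hU : {x | y < u x} = ⋃ k, {x | z k < u x} := by
    ext x
    simp only [mem_ofPred_eq, mem_iUnion]
    constructor
    · intro hx
      exact (hlim.eventually (gt_mem_nhds hx)).exists
    · rintro ⟨k, hk⟩
      exact (hz' k).1.trans hk
  have hmono : Monotone fun k => {x | z k < u x} :=
    fun i j hij x hx => lt_of_le_of_lt (hz.antitone hij) hx
  rw [distribution, hU, hmono.measure_iUnion, lt_iSup_iff] at h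
  obtain ⟨k, hk⟩ := h
  exact ⟨z k, (hz' k).1, hk⟩

/-- The level sets of `u*` in `t` are determined by the distribution function; later rearrangement
estimates become measure computations through this equivalence. -/
lemma lt_rearrangement_iff {u : α → ℝ≥0∞} {t : ℝ} {y : ℝ≥0∞} :
    y < rearrangement μ u t ↔ ENNReal.ofReal t < distribution μ u y := by
  constructor
  · intro h
    by_contra! hd
    refine h.not_ge (le_of_forall_gt_imp_ge_of_dense fun z hz => ?_)
    rcases eq_or_ne z ∞ with rfl | hz'
    · exact le_top
    lift z to ℝ≥0 using hz'
    exact iInf₂_le z ⟨by exact_mod_cast (zero_le : 0 ≤ y).trans_lt hz,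
      (distribution_antitone u hz.le).trans hd⟩
  · intro h
    obtain ⟨z, hyz, hz⟩ := exists_distribution_gt h
    refine hyz.trans_le (le_iInf₂ fun v hv => ?_)
    by_contra! hvz
    exact (hz.trans_le ((distribution_antitone u hvz.le).trans hv.2)).false

lemma rearrangement_le_iff {u : α → ℝ≥0∞} {t : ℝ} {y : ℝ≥0∞} :
    rearrangement μ u t ≤ y ↔ distribution μ u y ≤ ENNReal.ofReal t := by
  simpa using lt_rearrangement_iff.not

lemma rearrangement_antitone (u : α → ℝ≥0∞) : Antitone (rearrangement μ u) := by
  intro s t hst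
  rw [rearrangement_le_iff]
  exact (rearrangement_le_iff.1 le_rfl).trans (ENNReal.ofReal_le_ofReal hst)

lemma rearrangement_le_of_distribution_le {β : Type*} [MeasurableSpace β] {ν : Measure β}
    {u : α → ℝ≥0∞} {v : β → ℝ≥0∞}
    (h : ∀ y, distribution μ u y ≤ distribution ν v y) (t : ℝ) :
    rearrangement μ u t ≤ rearrangement ν v t := by
  rw [rearrangement_le_iff]
  exact (h _).trans (rearrangement_le_iff.1 le_rfl)

lemma rearrangement_mono {u v : α → ℝ≥0∞} (h : u ≤ᵐ[μ] v) (t : ℝ) :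
    rearrangement μ u t ≤ rearrangement μ v t :=
  rearrangement_le_of_distribution_le (distribution_mono h) t

lemma rearrangement_add_const_le (u : α → ℝ≥0∞) (c : ℝ≥0∞) (t : ℝ) :
    rearrangement μ (fun x => u x + c) t ≤ rearrangement μ u t + c := by
  rw [rearrangement_le_iff]
  refine le_trans (measure_mono fun x hx => ?_) (rearrangement_le_iff.1 (le_refl (rearrangement μ u t)))
  exact lt_of_add_lt_add_right (a := c) hx

lemma rearrangement_const_mul (u : α → ℝ≥0∞) (c : ℝ≥0) (t : ℝ) :
    rearrangement μ (fun x => c * u x) t = c * rearrangement μ u t := by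
  rcases eq_or_ne c 0 with rfl | hc
  · simp [← nonpos_iff_eq_zero, rearrangement_le_iff, distribution]
  have hc' : (c : ℝ≥0∞) ≠ 0 := by simpa using hc
  refine eq_of_forall_lt_iff fun y => ?_
  rw [lt_rearrangement_iff, mul_comm, ← ENNReal.div_lt_iff (.inl hc') (.inl ENNReal.coe_ne_top),
    lt_rearrangement_iff, distribution, distribution]
  simp_rw [ENNReal.div_lt_iff (Or.inl hc') (Or.inl ENNReal.coe_ne_top), mul_comm]

/-- Layer-cake formula: Tonelli for the region under the graph, with `u` allowed to be infinite. -/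
lemma lintegral_eq_lintegral_distribution [SFinite μ] {u : α → ℝ≥0∞} (hu : AEMeasurable u μ) :
    ∫⁻ x, u x ∂μ = ∫⁻ y in Ioi (0 : ℝ), distribution μ u (ENNReal.ofReal y) := by
  wlog hm : Measurable u generalizing u
  · rw [lintegral_congr_ae hu.ae_eq_mk, this hu.measurable_mk.aemeasurable hu.measurable_mk]
    refine lintegral_congr fun y => le_antisymm (distribution_mono ?_ _) (distribution_mono ?_ _)
    · exact hu.ae_eq_mk.symm.le
    · exact hu.ae_eq_mk.le
  have hvol (a : ℝ≥0∞) : volume (Ioi 0 ∩ {y : ℝ | ENNReal.ofReal y < a}) = a := by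
    rcases eq_or_ne a ∞ with rfl | ha
    · simp
    lift a to ℝ≥0 using ha
    have : Ioi 0 ∩ {y : ℝ | ENNReal.ofReal y < a} = Ioo 0 (a : ℝ) := by
      ext y
      simp only [mem_inter_iff, mem_Ioi, mem_ofPred_eq, mem_Ioo]
      refine and_congr_right fun hy => ?_
      rw [← ENNReal.ofReal_coe_nnreal, ENNReal.ofReal_lt_ofReal_iff_of_nonneg hy.le]
    rw [this]
    simp
  have hS : MeasurableSet {p : α × ℝ | ENNReal.ofReal p.2 < u p.1} :=
    measurableSet_lt (ENNReal.measurable_ofReal.comp measurable_snd) (hm.comp measurable_fst)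
  calc ∫⁻ x, u x ∂μ = (μ.prod (volume.restrict (Ioi (0 : ℝ))))
        {p : α × ℝ | ENNReal.ofReal p.2 < u p.1} := by
        rw [Measure.prod_apply hS]
        refine lintegral_congr fun x => ?_
        rw [Measure.restrict_apply (measurable_prodMk_left hS), inter_comm]
        exact (hvol (u x)).symm
    _ = _ := Measure.prod_apply_symm hS

lemma volume_Ioo_inter_lt (T : ℝ) (D : ℝ≥0∞) :
    volume ({s : ℝ | ENNReal.ofReal s < D} ∩ Ioo 0 T) = min (ENNReal.ofReal T) D := by
  rcases eq_or_ne D ∞ with rfl | hD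
  · simp
  lift D to ℝ≥0 using hD
  have : {s : ℝ | ENNReal.ofReal s < D} ∩ Ioo 0 T = Ioo 0 (min T D) := by
    ext y
    simp only [mem_inter_iff, mem_ofPred_eq, mem_Ioo, lt_min_iff]
    constructor
    · rintro ⟨h1, h2, h3⟩
      rw [← ENNReal.ofReal_coe_nnreal, ENNReal.ofReal_lt_ofReal_iff_of_nonneg h2.le] at h1
      exact ⟨h2, h3, h1⟩
    · rintro ⟨h2, h3, h1⟩
      rw [← ENNReal.ofReal_coe_nnreal, ENNReal.ofReal_lt_ofReal_iff_of_nonneg h2.le]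
      exact ⟨h1, h2, h3⟩
  rw [this, Real.volume_Ioo, sub_zero, ENNReal.ofReal_mono.map_min, ENNReal.ofReal_coe_nnreal]

/-- On `(0,T)` the set `{u* > y}` is an initial interval of length `min(T, λ_u(y))`; apply the
layer-cake formula. -/
lemma lintegral_rearrangement (u : α → ℝ≥0∞) (T : ℝ) :
    ∫⁻ s in Ioo 0 T, rearrangement μ u s =
      ∫⁻ y in Ioi (0 : ℝ), min (ENNReal.ofReal T) (distribution μ u (ENNReal.ofReal y)) := by
  rw [lintegral_eq_lintegral_distribution (rearrangement_antitone u).measurable.aemeasurable]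
  refine lintegral_congr fun y => ?_
  rw [distribution, Measure.restrict_apply
    (measurableSet_lt measurable_const (rearrangement_antitone u).measurable)]
  simp_rw [lt_rearrangement_iff]
  exact volume_Ioo_inter_lt T _

/-- Hardy–Littlewood: the distribution function of `u` on `A` is at most both `μ A` and that of `u`.
-/
lemma setLIntegral_le_lintegral_rearrangement [SFinite μ] {u : α → ℝ≥0∞} (hu : AEMeasurable u μ)
    {A : Set α} {T : ℝ} (hT : μ A ≤ ENNReal.ofReal T) :
    ∫⁻ x in A, u x ∂μ ≤ ∫⁻ s in Ioo 0 T, rearrangement μ u s := by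
  rw [lintegral_rearrangement, lintegral_eq_lintegral_distribution hu.restrict]
  refine lintegral_mono fun y => le_min ?_ ?_
  · refine le_trans (measure_mono (subset_univ _)) ?_
    simpa using hT
  · exact Measure.restrict_apply_le _ _

lemma lintegral_rearrangement_le [SFinite μ] {u : α → ℝ≥0∞} (hu : AEMeasurable u μ) (T : ℝ) :
    ∫⁻ s in Ioo 0 T, rearrangement μ u s ≤ ∫⁻ x, u x ∂μ := by
  rw [lintegral_rearrangement, lintegral_eq_lintegral_distribution hu]
  exact lintegral_mono fun y => min_le_right _ _

lemma mul_rearrangement_le (u : α → ℝ≥0∞) (t : ℝ) :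
    ENNReal.ofReal t * rearrangement μ u t ≤ ∫⁻ s in Ioo 0 t, rearrangement μ u s := by
  calc ENNReal.ofReal t * rearrangement μ u t = ∫⁻ _ in Ioo 0 t, rearrangement μ u t := by
        simp [mul_comm]
    _ ≤ _ := setLIntegral_mono' measurableSet_Ioo fun s hs => rearrangement_antitone u hs.2.le

lemma mul_rearrangement₂ (u : α → ℝ≥0∞) {t : ℝ} (ht : 0 < t) :
    ENNReal.ofReal t * rearrangement₂ μ u t = ∫⁻ s in Ioo 0 t, rearrangement μ u s := by
  rw [rearrangement₂, ← mul_assoc, ENNReal.mul_inv_cancel (by simpa using ht) ENNReal.ofReal_ne_top,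
    one_mul]

lemma rearrangement_le_rearrangement₂ (u : α → ℝ≥0∞) {t : ℝ} (ht : 0 < t) :
    rearrangement μ u t ≤ rearrangement₂ μ u t := by
  have h := mul_rearrangement_le (μ := μ) u t
  rwa [← mul_rearrangement₂ u ht,
    ENNReal.mul_le_mul_iff_right (by simpa using ht) ENNReal.ofReal_ne_top] at h

lemma rearrangement₂_mono {u v : α → ℝ≥0∞} (h : u ≤ᵐ[μ] v) (t : ℝ) :
    rearrangement₂ μ u t ≤ rearrangement₂ μ v t := by
  unfold rearrangement₂
  gcongr
  exact rearrangement_mono h _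

lemma rearrangement₂_const_mul (u : α → ℝ≥0∞) (c : ℝ≥0) (t : ℝ) :
    rearrangement₂ μ (fun x => c * u x) t = c * rearrangement₂ μ u t := by
  simp_rw [rearrangement₂, rearrangement_const_mul]
  rw [lintegral_const_mul _ (rearrangement_antitone u).measurable, mul_left_comm]

end Rearrangement

/-! ### Polar coordinates and radial rearrangement -/

section Radial

lemma lintegral_fun_norm_addHaar {E : Type*} [NormedAddCommGroup E] [NormedSpace ℝ E]
    [FiniteDimensional ℝ E] [Nontrivial E] [MeasurableSpace E] [BorelSpace E] (μ : Measure E)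
    [μ.IsAddHaarMeasure] {f : ℝ → ℝ≥0∞} (hf : Measurable f) :
    ∫⁻ x, f ‖x‖ ∂μ = μ.toSphere univ *
      ∫⁻ y in Ioi (0 : ℝ), ENNReal.ofReal (y ^ (Module.finrank ℝ E - 1)) * f y := by
  have hm : Measurable fun y : Ioi (0 : ℝ) => f y := hf.comp measurable_subtype_coe
  have h := μ.measurePreserving_homeomorphUnitSphereProd.lintegral_comp
    (f := fun p => f (p.2 : ℝ)) (hm.comp measurable_snd)
  simp only [homeomorphUnitSphereProd_apply_snd_coe] at h
  calc ∫⁻ x, f ‖x‖ ∂μ = ∫⁻ x in ({0}ᶜ : Set E), f ‖x‖ ∂μ := by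
        rw [restrict_compl_singleton]
    _ = ∫⁻ x : ({0}ᶜ : Set E), f ‖(x : E)‖ ∂(μ.comap (↑)) :=
        (lintegral_subtype_comap (MeasurableSet.singleton 0).compl _).symm
    _ = _ := by
        have h' := lintegral_prod (μ := μ.toSphere)
          (ν := Measure.volumeIoiPow (Module.finrank ℝ E - 1)) (fun p => f (p.2 : ℝ))
          (hm.comp measurable_snd).aemeasurable
        simp only [lintegral_const] at h'
        rw [h, h', mul_comm, Measure.volumeIoiPow, lintegral_withDensity_eq_lintegral_mul _
          (by fun_prop) hm]
        congr 1
        exact lintegral_subtype_comap measurableSet_Ioi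
          (fun y : ℝ => ENNReal.ofReal (y ^ (Module.finrank ℝ E - 1)) * f y)

/-- The volume of the unit ball of `ℝⁿ`. -/
noncomputable def unitBallVolume (n : ℕ) : ℝ := (volume (Metric.ball (0 : Rn n) 1)).toReal

lemma unitBallVolume_pos (n : ℕ) : 0 < unitBallVolume n :=
  ENNReal.toReal_pos (Metric.measure_ball_pos _ _ one_pos).ne' measure_ball_lt_top.ne

lemma volume_ball_eq {n : ℕ} (x : Rn n) {r : ℝ} (hr : 0 < r) :
    volume (Metric.ball x r) = ENNReal.ofReal (unitBallVolume n * r ^ n) := by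
  rw [Measure.addHaar_ball_of_pos _ _ hr, finrank_euclideanSpace_fin, mul_comm,
    ENNReal.ofReal_mul (unitBallVolume_pos n).le, unitBallVolume,
    ENNReal.ofReal_toReal measure_ball_lt_top.ne]

lemma pow_rpow_inv {n : ℕ} (hn : 1 ≤ n) {r : ℝ} (hr : 0 ≤ r) : (r ^ n) ^ (1 / (n : ℝ)) = r := by
  rw [one_div]
  exact Real.pow_rpow_inv_natCast hr (by omega)

lemma rpow_inv_pow {n : ℕ} (hn : 1 ≤ n) {r : ℝ} (hr : 0 ≤ r) : (r ^ (1 / (n : ℝ))) ^ n = r := by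
  rw [one_div]
  exact Real.rpow_inv_natCast_pow hr (by omega)

lemma volume_norm_pow_lt {n : ℕ} (hn : 1 ≤ n) (D : ℝ≥0∞) :
    volume {x : Rn n | ENNReal.ofReal (unitBallVolume n * ‖x‖ ^ n) < D} = D := by
  have : Nonempty (Fin n) := ⟨⟨0, hn⟩⟩
  have hω := unitBallVolume_pos n
  rcases eq_or_ne D ∞ with rfl | hD
  · simp
  lift D to ℝ≥0 using hD
  rcases eq_or_ne D 0 with rfl | hD
  · simp
  have hD' : (0 : ℝ) < D := by positivity
  have hb : {x : Rn n | ENNReal.ofReal (unitBallVolume n * ‖x‖ ^ n) < D} =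
      Metric.ball 0 ((D / unitBallVolume n) ^ (1 / (n : ℝ))) := by
    ext x
    rw [mem_ofPred_eq, mem_ball_zero_iff, ← ENNReal.ofReal_coe_nnreal,
      ENNReal.ofReal_lt_ofReal_iff hD', mul_comm, ← lt_div_iff₀ hω,
      ← pow_lt_pow_iff_left₀ (norm_nonneg x) (by positivity) (show n ≠ 0 by omega),
      rpow_inv_pow hn (by positivity)]
  rw [hb, volume_ball_eq _ (by positivity), rpow_inv_pow hn (by positivity),
    mul_div_cancel₀ _ hω.ne', ENNReal.ofReal_coe_nnreal]

/-- The integral of `u*` over `(0,t)`. -/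
noncomputable def primitive {α : Type*} [MeasurableSpace α] (μ : Measure α) (u : α → ℝ≥0∞)
    (t : ℝ) : ℝ≥0∞ :=
  ∫⁻ s in Ioo 0 t, rearrangement μ u s

lemma primitive_mono_right {α : Type*} [MeasurableSpace α] (μ : Measure α) (u : α → ℝ≥0∞) :
    Monotone (primitive μ u) :=
  fun _ _ h => lintegral_mono_set (Ioo_subset_Ioo_right h)

lemma measurable_radial {n : ℕ} {F : ℝ → ℝ≥0∞} (hF : Antitone F) :
    Measurable fun x : Rn n => F (unitBallVolume n * ‖x‖ ^ n) :=
  hF.measurable.comp (by fun_prop)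

lemma distribution_radial {α : Type*} [MeasurableSpace α] {μ : Measure α} {n : ℕ}
    (hn : 1 ≤ n) (u : α → ℝ≥0∞) (y : ℝ≥0∞) :
    distribution volume (fun x : Rn n => rearrangement μ u (unitBallVolume n * ‖x‖ ^ n)) y =
      distribution μ u y := by
  simp_rw [distribution, lt_rearrangement_iff]
  exact volume_norm_pow_lt hn _

/-- The superlevel sets of the radial function are concentric with the ball, so intersecting with it
takes the minimum of the two volumes, as in `lintegral_rearrangement`. -/
lemma setLIntegral_ball_radial {α : Type*} [MeasurableSpace α] {μ : Measure α} {n : ℕ}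
    (hn : 1 ≤ n) (u : α → ℝ≥0∞) {r : ℝ} (hr : 0 < r) :
    ∫⁻ x in Metric.ball (0 : Rn n) r, rearrangement μ u (unitBallVolume n * ‖x‖ ^ n) =
      primitive μ u (unitBallVolume n * r ^ n) := by
  have hω := unitBallVolume_pos n
  have hm : Measurable fun x : Rn n => rearrangement μ u (unitBallVolume n * ‖x‖ ^ n) :=
    measurable_radial (rearrangement_antitone u)
  rw [primitive, lintegral_rearrangement, lintegral_eq_lintegral_distribution hm.aemeasurable]
  refine lintegral_congr fun y => ?_
  rw [distribution, Measure.restrict_apply (measurableSet_lt measurable_const hm)]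
  simp_rw [lt_rearrangement_iff]
  rw [← volume_norm_pow_lt hn (min _ _)]
  congr 1
  ext x
  rw [mem_inter_iff, mem_ofPred_eq, mem_ofPred_eq, mem_ball_zero_iff, lt_min_iff, and_comm,
    ENNReal.ofReal_lt_ofReal_iff (by positivity), mul_lt_mul_iff_right₀ hω,
    pow_lt_pow_iff_left₀ (norm_nonneg x) hr.le (by omega)]

end Radial

/-! ### Consequences of the `B_n(∞)` condition -/

section Weights

variable {n : ℕ} {Φ : ℝ → ℝ}

/-- On `(r/2, r)` the integrand is at least `Φ(r) (r/2)^(n-1)`, so the integral up to `s ≥ r` is at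
least `Φ(r) (r/2)^n`. -/
lemma ClassB.exists_mul_pow_le (hn : 1 ≤ n) (hB : ClassB n Φ) :
    ∃ C : ℝ, 0 < C ∧ ∀ r s : ℝ, 0 < r → r ≤ s → Φ r * r ^ n ≤ C * (Φ s * s ^ n) := by
  obtain ⟨C, hC, h⟩ := hB.integral_le
  refine ⟨2 ^ n * C, by positivity, fun r s hr hrs => ?_⟩
  have hs := hr.trans_le hrs
  have hΦr := hB.pos r hr
  have hΦs := hB.pos s hs
  have h1 : ENNReal.ofReal (Φ r * (r / 2) ^ (n - 1) * (r / 2)) ≤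
      ENNReal.ofReal (C * (Φ s * s ^ n)) := by
    refine le_trans ?_ (h s hs)
    calc ENNReal.ofReal (Φ r * (r / 2) ^ (n - 1) * (r / 2))
        = ∫⁻ _ in Ioo (r / 2) r, ENNReal.ofReal (Φ r * (r / 2) ^ (n - 1)) := by
          rw [setLIntegral_const, Real.volume_Ioo, ← ENNReal.ofReal_mul (by positivity)]
          ring_nf
      _ ≤ ∫⁻ x in Ioo (r / 2) r, ENNReal.ofReal (Φ x * x ^ (n - 1)) := by
          refine setLIntegral_mono' measurableSet_Ioo fun x hx => ENNReal.ofReal_le_ofReal ?_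
          have hx0 : 0 < x := (half_pos hr).trans hx.1
          have := hB.antitoneOn hx0 hr hx.2.le
          have := hx.1.le
          have := hB.pos x hx0
          gcongr
      _ ≤ _ := lintegral_mono_set (Ioo_subset_Ioo (by positivity) hrs)
  rw [ENNReal.ofReal_le_ofReal_iff (by positivity), mul_assoc, ← pow_succ,
    Nat.sub_add_cancel hn, div_pow, mul_div_assoc', div_le_iff₀ (by positivity)] at h1
  linarith

lemma ClassB.exists_le_mul (hn : 1 ≤ n) (hB : ClassB n Φ) {l : ℝ} (hl : 1 ≤ l) :
    ∃ C : ℝ, 0 < C ∧ ∀ r : ℝ, 0 < r → Φ r ≤ C * Φ (l * r) := by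
  obtain ⟨C, hC, h⟩ := hB.exists_mul_pow_le hn
  refine ⟨C * l ^ n, by positivity, fun r hr => ?_⟩
  have := h r (l * r) hr (le_mul_of_one_le_left hr.le hl)
  refine le_of_mul_le_mul_right (this.trans_eq ?_) (pow_pos hr n)
  rw [mul_pow]
  ring

lemma ClassB.measurable_indicator (hB : ClassB n Φ) (r : ℝ) :
    Measurable ((Ioo 0 r).indicator fun s => ENNReal.ofReal (Φ s)) := by
  classical
  rw [← piecewise_eq_indicator]
  refine ContinuousOn.measurable_piecewise ?_ continuousOn_const measurableSet_Ioo
  exact ENNReal.continuous_ofReal.comp_continuousOn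
    (hB.continuousOn.mono Ioo_subset_Ioi_self)

/-- In polar coordinates this is the `B_n(∞)` integral times the area of the sphere. -/
lemma ClassB.exists_lintegral_norm_le (hn : 1 ≤ n) (hB : ClassB n Φ) :
    ∃ C : ℝ≥0, ∀ r : ℝ, 0 < r →
      ∫⁻ x : Rn n, (Ioo 0 r).indicator (fun s => ENNReal.ofReal (Φ s)) ‖x‖ ≤
        C * ENNReal.ofReal (Φ r * r ^ n) := by
  have : Nonempty (Fin n) := ⟨⟨0, hn⟩⟩
  obtain ⟨C, hC, h⟩ := hB.integral_le
  refine ⟨((volume : Measure (Rn n)).toSphere univ).toNNReal * C.toNNReal, fun r hr => ?_⟩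
  rw [lintegral_fun_norm_addHaar volume (hB.measurable_indicator r), finrank_euclideanSpace_fin,
    ENNReal.coe_mul, ENNReal.coe_toNNReal (measure_ne_top _ _), mul_assoc]
  gcongr
  rw [← ENNReal.ofReal, ← ENNReal.ofReal_mul hC.le]
  refine le_trans (le_of_eq ?_) (h r hr)
  rw [← lintegral_indicator measurableSet_Ioo, ← lintegral_indicator measurableSet_Ioi]
  refine lintegral_congr fun y => ?_
  by_cases hy : y ∈ Ioo 0 r
  · rw [indicator_of_mem (mem_Ioi.2 hy.1), indicator_of_mem hy, indicator_of_mem hy,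
      ← ENNReal.ofReal_mul (pow_nonneg hy.1.le _), mul_comm]
  · rw [indicator_of_notMem hy]
    simp [indicator_of_notMem hy]

end Weights

/-! ### Pointwise estimates against `supStarStar` -/

section Estimates

variable {n : ℕ} {Φ : ℝ → ℝ}

lemma ofReal_mul_starStar (c : ℝ) (u : Rn n → ℝ≥0∞) (t : Rpos) :
    ENNReal.ofReal (t * c) * starStar u t = ENNReal.ofReal c * primitive volume u t := by
  have ht : (0 : ℝ) < t := t.2
  rw [mul_comm (t : ℝ), ENNReal.ofReal_mul' ht.le, mul_assoc, starStar, mul_rearrangement₂ _ ht,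
    primitive]

lemma supStarStar_eq (Φ : ℝ → ℝ) (f : Rn n → ℂ) (t : Rpos) :
    supStarStar Φ f t = ⨆ (τ : Rpos) (_ : t < τ),
      ENNReal.ofReal (Φ ((τ : ℝ) ^ (1 / (n : ℝ)))) * primitive volume (fun x => ‖f x‖ₑ) τ := by
  simp_rw [supStarStar, ofReal_mul_starStar]

lemma mul_primitive_le_supStarStar (Φ : ℝ → ℝ) (f : Rn n → ℂ) (t : Rpos) {τ : ℝ}
    (h : (t : ℝ) < τ) :
    ENNReal.ofReal (Φ (τ ^ (1 / (n : ℝ)))) * primitive volume (fun x => ‖f x‖ₑ) τ ≤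
      supStarStar Φ f t := by
  rw [supStarStar_eq]
  exact le_iSup₂_of_le (⟨τ, lt_trans t.2 h⟩ : Rpos) h le_rfl

/-- The supremum omits the endpoint `τ = t`; use `τ = 2ⁿ t` instead, which by doubling costs only a
constant. -/
lemma ClassB.exists_mul_primitive_le (hn : 1 ≤ n) (hB : ClassB n Φ) :
    ∃ C : ℝ≥0, ∀ (f : Rn n → ℂ) (t : Rpos),
      ENNReal.ofReal (Φ ((t : ℝ) ^ (1 / (n : ℝ)))) * primitive volume (fun x => ‖f x‖ₑ) t ≤
        C * supStarStar Φ f t := by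
  obtain ⟨C, hC, h⟩ := hB.exists_le_mul hn one_le_two
  refine ⟨C.toNNReal, fun f t => ?_⟩
  have ht : (0 : ℝ) < t := t.2
  have h2 : (1 : ℝ) < 2 ^ n := one_lt_pow₀ one_lt_two (by omega)
  have h2' : (t : ℝ) < 2 ^ n * t := lt_mul_of_one_lt_left ht h2
  calc ENNReal.ofReal (Φ ((t : ℝ) ^ (1 / (n : ℝ)))) * primitive volume (fun x => ‖f x‖ₑ) t
      ≤ ENNReal.ofReal (C * Φ ((2 ^ n * t : ℝ) ^ (1 / (n : ℝ)))) *
          primitive volume (fun x => ‖f x‖ₑ) (2 ^ n * t) := by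
        gcongr
        · rw [Real.mul_rpow (by positivity) ht.le, pow_rpow_inv hn zero_le_two]
          exact h _ (by positivity)
        · exact primitive_mono_right _ _ h2'.le
    _ = C.toNNReal * (ENNReal.ofReal (Φ ((2 ^ n * t : ℝ) ^ (1 / (n : ℝ)))) *
          primitive volume (fun x => ‖f x‖ₑ) (2 ^ n * t)) := by
        rw [ENNReal.ofReal_mul hC.le, mul_assoc, ENNReal.ofReal]
    _ ≤ _ := by
        gcongr
        exact mul_primitive_le_supStarStar Φ f t h2'

lemma ClassB.exists_starStarAddSupStar_le (hn : 1 ≤ n) (hB : ClassB n Φ) :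
    ∃ C : ℝ≥0, ∀ (f : Rn n → ℂ) (t : Rpos),
      starStarAddSupStar Φ f t ≤ C * supStarStar Φ f t := by
  obtain ⟨C, h⟩ := hB.exists_mul_primitive_le hn
  refine ⟨C + 1, fun f t => ?_⟩
  rw [ENNReal.coe_add, add_mul, ENNReal.coe_one, one_mul, starStarAddSupStar]
  refine add_le_add ?_ ?_
  · rw [ofReal_mul_starStar]
    exact h f t
  · unfold supStarStar star starStar
    gcongr with τ _
    exact rearrangement_le_rearrangement₂ _ τ.2

lemma primitive_le_add {α : Type*} [MeasurableSpace α] (μ : Measure α) (u : α → ℝ≥0∞) (t τ : ℝ) :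
    primitive μ u τ ≤ primitive μ u t + ∫⁻ s in Ioo t τ, rearrangement μ u s := by
  rw [primitive, primitive, setLIntegral_congr (Ioo_ae_eq_Ico (a := t) (b := τ))]
  refine le_trans (lintegral_mono_set fun s hs => ?_) (lintegral_union_le _ _ _)
  rcases lt_or_ge s t with h | h
  · exact .inl ⟨hs.1, h⟩
  · exact .inr ⟨h, hs.2⟩

/-- Split `∫₀^τ f*` at `t`. Beyond `t`, `f*(s) ≤ S / (s Φ(s^(1/n)))` with `S` the supremum in `B f`,
and `D(∞)` integrates this to `C S / Φ(τ^(1/n))`. -/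
lemma exists_supStarStar_le (hn : 1 ≤ n) (hB : ClassB n Φ) (hD : ClassD n Φ) :
    ∃ C : ℝ≥0, ∀ (f : Rn n → ℂ) (t : Rpos),
      supStarStar Φ f t ≤ C * starStarAddSupStar Φ f t := by
  obtain ⟨C, hC, h⟩ := hD.integral_le
  refine ⟨1 + C.toNNReal, fun f t => ?_⟩
  have ht : (0 : ℝ) < t := t.2
  rw [supStarStar_eq]
  refine iSup₂_le fun τ hτ => ?_
  have hτ0 : (0 : ℝ) < τ := τ.2
  set u : Rn n → ℝ≥0∞ := fun x => ‖f x‖ₑ with hu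
  set S := ⨆ (τ : Rpos) (_ : t < τ),
      ENNReal.ofReal (τ * Φ ((τ : ℝ) ^ (1 / (n : ℝ)))) * star u τ with hS
  have hT : starStarAddSupStar Φ f t =
      ENNReal.ofReal (Φ ((t : ℝ) ^ (1 / (n : ℝ)))) * primitive volume u t + S := by
    rw [starStarAddSupStar, ofReal_mul_starStar]
  rw [hT]
  rcases eq_or_ne S ∞ with hSt | hSt
  · rw [hSt, add_top, ENNReal.mul_top (by simp)]
    exact le_top
  have hΦτ : 0 < Φ ((τ : ℝ) ^ (1 / (n : ℝ))) := hB.pos _ (by positivity)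
  have hI : ∫⁻ s in Ioo (t : ℝ) τ, rearrangement volume u s ≤
      S * ENNReal.ofReal (C / Φ ((τ : ℝ) ^ (1 / (n : ℝ)))) := by
    calc ∫⁻ s in Ioo (t : ℝ) τ, rearrangement volume u s
        ≤ ∫⁻ s in Ioo (t : ℝ) τ, S * ENNReal.ofReal (1 / (Φ (s ^ (1 / (n : ℝ))) * s)) := by
          refine setLIntegral_mono' measurableSet_Ioo fun s hs => ?_
          have hs0 : 0 < s := ht.trans hs.1
          have hΦs : 0 < Φ (s ^ (1 / (n : ℝ))) := hB.pos _ (by positivity)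
          have h1 : ENNReal.ofReal (s * Φ (s ^ (1 / (n : ℝ)))) * rearrangement volume u s ≤ S :=
            le_iSup₂_of_le (⟨s, hs0⟩ : Rpos) hs.1 le_rfl
          calc rearrangement volume u s
              = ENNReal.ofReal (s * Φ (s ^ (1 / (n : ℝ)))) * rearrangement volume u s *
                ENNReal.ofReal (1 / (Φ (s ^ (1 / (n : ℝ))) * s)) := by
                rw [mul_right_comm, ← ENNReal.ofReal_mul (by positivity), mul_comm s,
                  mul_one_div_cancel (by positivity), ENNReal.ofReal_one, one_mul]
            _ ≤ _ := by gcongr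
      _ = S * ∫⁻ s in Ioo (t : ℝ) τ, ENNReal.ofReal (1 / (Φ (s ^ (1 / (n : ℝ))) * s)) :=
          lintegral_const_mul' _ _ hSt
      _ ≤ _ := by
          gcongr
          refine le_trans (lintegral_mono_set ?_) (h ((τ : ℝ) ^ (1 / (n : ℝ))) (by positivity))
          rw [rpow_inv_pow hn hτ0.le]
          exact Ioo_subset_Ioo_left ht.le
  calc ENNReal.ofReal (Φ ((τ : ℝ) ^ (1 / (n : ℝ)))) * primitive volume u τ
      ≤ ENNReal.ofReal (Φ ((τ : ℝ) ^ (1 / (n : ℝ)))) * (primitive volume u t +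
          S * ENNReal.ofReal (C / Φ ((τ : ℝ) ^ (1 / (n : ℝ))))) := by
        gcongr
        exact (primitive_le_add _ _ _ _).trans (by gcongr)
    _ = ENNReal.ofReal (Φ ((τ : ℝ) ^ (1 / (n : ℝ)))) * primitive volume u t +
          C.toNNReal * S := by
        rw [mul_add, mul_left_comm, ← ENNReal.ofReal_mul hΦτ.le, mul_div_cancel₀ _ hΦτ.ne',
          mul_comm S]
        rfl
    _ ≤ 1 * (ENNReal.ofReal (Φ ((t : ℝ) ^ (1 / (n : ℝ)))) * primitive volume u t + S) +
          C.toNNReal * (ENNReal.ofReal (Φ ((t : ℝ) ^ (1 / (n : ℝ)))) * primitive volume u t + S) := by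
        rw [one_mul]
        gcongr
        · refine le_add_right ?_
          gcongr
          refine hB.antitoneOn (mem_Ioi.2 (by positivity)) (mem_Ioi.2 (by positivity)) ?_
          have : (t : ℝ) ≤ τ := hτ.le
          gcongr
        · exact le_add_left le_rfl
    _ = _ := by rw [ENNReal.coe_add, add_mul, ENNReal.coe_one]

lemma rearrangement₂_le_of_le_add {u v : Rn n → ℝ≥0∞} (hv : AEMeasurable v) {c : ℝ≥0∞}
    (h : ∀ x, u x ≤ v x + c) {t : ℝ} (ht : 0 < t) :
    rearrangement₂ volume u t ≤ (ENNReal.ofReal t)⁻¹ * (∫⁻ x, v x) + c := by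
  calc rearrangement₂ volume u t
      ≤ (ENNReal.ofReal t)⁻¹ * ∫⁻ τ in Ioo 0 t, (rearrangement volume v τ + c) := by
        unfold rearrangement₂
        gcongr with τ
        exact (rearrangement_mono (.of_forall h) τ).trans (rearrangement_add_const_le _ _ _)
    _ = (ENNReal.ofReal t)⁻¹ * (∫⁻ τ in Ioo 0 t, rearrangement volume v τ) + c := by
        rw [lintegral_add_right _ measurable_const, setLIntegral_const, Real.volume_Ioo, sub_zero,
          mul_add, mul_comm c, ← mul_assoc _ _ c, ENNReal.inv_mul_cancel (by simpa using ht)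
            ENNReal.ofReal_ne_top, one_mul]
    _ ≤ _ := by
        gcongr
        exact lintegral_rearrangement_le hv t

lemma maximal_congr_ae {f g : Rn n → ℂ} (h : f =ᵐ[volume] g) (Φ : ℝ → ℝ) :
    maximal Φ f = maximal Φ g := by
  ext x
  unfold maximal
  have h' (r : ℝ) : ∫⁻ y in Metric.ball x r, ‖f y‖ₑ = ∫⁻ y in Metric.ball x r, ‖g y‖ₑ :=
    lintegral_congr_ae (ae_restrict_of_ae (h.mono fun y hy => congrArg enorm hy))
  simp_rw [h']

lemma supStarStar_mono (Φ : ℝ → ℝ) {f g : Rn n → ℂ} (h : ∀ᵐ x, ‖f x‖ₑ ≤ ‖g x‖ₑ) (t : Rpos) :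
    supStarStar Φ f t ≤ supStarStar Φ g t := by
  unfold supStarStar starStar
  gcongr
  exact rearrangement₂_mono h _

/-- A convolution dominates the part of the maximal function coming from small balls. -/
lemma ClassB.mul_setLIntegral_ball_le (hB : ClassB n Φ) (g : Rn n → ℝ≥0∞) (x : Rn n) {r R : ℝ}
    (hr : 0 < r) (hrR : r < R) (hn : 1 ≤ n) :
    ENNReal.ofReal (Φ r) * ∫⁻ y in Metric.ball x r, g y ≤
      ∫⁻ y, g y * (Ioo 0 R).indicator (fun s => ENNReal.ofReal (Φ s)) ‖y - x‖ := by
  have : Nonempty (Fin n) := ⟨⟨0, hn⟩⟩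
  rw [← lintegral_const_mul' _ _ ENNReal.ofReal_ne_top]
  refine le_trans ?_ (setLIntegral_le_lintegral (Metric.ball x r) _)
  refine lintegral_mono_ae ?_
  -- The centre `y = x` is discarded because the truncated kernel vanishes at the origin.
  filter_upwards [ae_restrict_mem Metric.isOpen_ball.measurableSet,
    ae_restrict_of_ae (Measure.ae_ne volume x)] with y hy hyx
  rw [mem_ball_iff_norm] at hy
  have h0 : 0 < ‖y - x‖ := norm_pos_iff.2 (sub_ne_zero.2 hyx)
  rw [indicator_of_mem (show ‖y - x‖ ∈ Ioo 0 R from ⟨h0, hy.trans hrR⟩), mul_comm]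
  gcongr
  exact hB.antitoneOn h0 hr hy.le

lemma lintegral_lintegral_mul_norm_sub {g : Rn n → ℝ≥0∞} {k : ℝ → ℝ≥0∞}
    (hg : Measurable g) (hk : Measurable k) :
    ∫⁻ x, ∫⁻ y, g y * k ‖y - x‖ = (∫⁻ y, g y) * ∫⁻ z : Rn n, k ‖z‖ := by
  rw [lintegral_lintegral_swap (by fun_prop), ← lintegral_mul_const _ hg]
  refine lintegral_congr fun y => ?_
  rw [lintegral_const_mul _ (by fun_prop)]
  congr 1
  exact lintegral_sub_left_eq_self (fun z => k ‖z‖) y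

lemma ClassB.exists_starStar_maximal_le (hn : 1 ≤ n) (hB : ClassB n Φ) :
    ∃ C : ℝ≥0, ∀ (f : Rn n → ℂ), AEMeasurable f → ∀ t : Rpos,
      starStar (maximal Φ f) t ≤ C * supStarStar Φ f t := by
  obtain ⟨C₁, hC₁, h₁⟩ := hB.exists_mul_pow_le hn
  obtain ⟨C₂, h₂⟩ := hB.exists_mul_primitive_le hn
  obtain ⟨C₃, h₃⟩ := hB.exists_lintegral_norm_le hn
  set ω := unitBallVolume n
  have hω : 0 < ω := unitBallVolume_pos n
  -- `Lⁿ ≥ ω` makes `(2Lr)ⁿ` at least the volume of a ball of radius `r`; the factor 2 makes it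
  -- strictly larger than `t` when `r ≥ R`.
  set L := max 1 ω
  have hL : 1 ≤ L := le_max_left _ _
  have hLω : ω ≤ L ^ n := (le_max_right _ _).trans (le_self_pow₀ hL (by omega))
  obtain ⟨C₄, hC₄, h₄⟩ := hB.exists_le_mul hn (show 1 ≤ 2 * L by linarith)
  refine ⟨C₃ * C₂ + (C₄.toNNReal + (ω * C₁).toNNReal * C₂), fun f hf t => ?_⟩
  wlog hfm : Measurable f generalizing f
  · have h := this hf.mk hf.measurable_mk.aemeasurable hf.measurable_mk
    rw [maximal_congr_ae hf.ae_eq_mk]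
    refine h.trans ?_
    gcongr
    exact supStarStar_mono Φ (hf.ae_eq_mk.mono fun x hx => by rw [hx]) t
  have ht : (0 : ℝ) < t := t.2
  set R : ℝ := (t : ℝ) ^ (1 / (n : ℝ))
  have hR : 0 < R := by positivity
  have hRn : R ^ n = t := rpow_inv_pow hn ht.le
  set u : Rn n → ℝ≥0∞ := fun x => ‖f x‖ₑ
  have hu : Measurable u := hfm.enorm
  set a := rearrangement volume u t
  set A := {x | a < u x}
  have hA : MeasurableSet A := measurableSet_lt measurable_const hu
  have hAt : volume A ≤ ENNReal.ofReal t := rearrangement_le_iff.1 le_rfl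
  set k := (Ioo 0 R).indicator fun s => ENNReal.ofReal (Φ s)
  have hk : Measurable k := hB.measurable_indicator R
  have hg : Measurable (A.indicator u) := hu.indicator hA
  set T := supStarStar Φ f t
  have hP : ENNReal.ofReal (Φ R) * primitive volume u t ≤ C₂ * T := h₂ f t
  have hmax : ∀ x, maximal Φ f x ≤ (∫⁻ y, A.indicator u y * k ‖y - x‖) +
      (C₄.toNNReal + (ω * C₁).toNNReal * C₂) * T := by
    intro x
    refine iSup₂_le fun r hr => ?_
    -- For `r < R` the part of `f` below `a` contributes at most a multiple of `Φ(R) t a`, and `t a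
    -- ≤ ∫₀ᵗ f*`. For `r ≥ R` no splitting of `f` is needed.
    rcases lt_or_ge r R with hrR | hrR
    · calc ENNReal.ofReal (Φ r) * ∫⁻ y in Metric.ball x r, u y
          ≤ ENNReal.ofReal (Φ r) * ∫⁻ y in Metric.ball x r, (A.indicator u y + a) := by
            gcongr with y
            by_cases hy : y ∈ A
            · rw [indicator_of_mem hy]
              exact le_self_add
            · rw [indicator_of_notMem hy, zero_add]
              exact not_lt.1 hy
        _ = ENNReal.ofReal (Φ r) * (∫⁻ y in Metric.ball x r, A.indicator u y) +
              ENNReal.ofReal (Φ r * (ω * r ^ n)) * a := by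
            rw [lintegral_add_right _ measurable_const, setLIntegral_const, volume_ball_eq _ hr,
              mul_add, ENNReal.ofReal_mul (hB.pos r hr).le, mul_comm a, mul_assoc]
        _ ≤ (∫⁻ y, A.indicator u y * k ‖y - x‖) + (ω * C₁).toNNReal * C₂ * T := by
            refine add_le_add (hB.mul_setLIntegral_ball_le _ x hr hrR hn) ?_
            · calc ENNReal.ofReal (Φ r * (ω * r ^ n)) * a
                  ≤ ENNReal.ofReal (ω * C₁ * (Φ R * t)) * a := by
                    refine mul_le_mul_left (ENNReal.ofReal_le_ofReal ?_) _
                    have := mul_le_mul_of_nonneg_left (h₁ r R hr hrR.le) hω.le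
                    rw [hRn] at this
                    linarith
                _ = (ω * C₁).toNNReal * (ENNReal.ofReal (Φ R) * (ENNReal.ofReal t * a)) := by
                    rw [ENNReal.ofReal_mul (by positivity), ENNReal.ofReal_mul (hB.pos R hR).le,
                      mul_assoc, mul_assoc, ENNReal.ofReal]
                _ ≤ (ω * C₁).toNNReal * (C₂ * T) := by
                    refine mul_le_mul_right (le_trans ?_ hP) _
                    gcongr
                    exact mul_rearrangement_le u t
                _ = _ := (mul_assoc _ _ _).symm
        _ ≤ _ := by
            rw [add_mul]
            exact add_le_add le_rfl le_add_self
    · have hτ : (t : ℝ) < (2 * L * r) ^ n := by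
        rw [← hRn]
        have : R < 2 * L * r := by nlinarith
        gcongr
      calc ENNReal.ofReal (Φ r) * ∫⁻ y in Metric.ball x r, u y
          ≤ ENNReal.ofReal (C₄ * Φ (2 * L * r)) * primitive volume u ((2 * L * r) ^ n) := by
            gcongr
            · exact h₄ r hr
            · refine setLIntegral_le_lintegral_rearrangement hu.aemeasurable ?_
              rw [volume_ball_eq _ hr, mul_pow, mul_pow]
              gcongr
              exact hLω.trans (le_mul_of_one_le_left (by positivity) (one_le_pow₀ one_le_two))
        _ = C₄.toNNReal * (ENNReal.ofReal (Φ (((2 * L * r) ^ n) ^ (1 / (n : ℝ)))) *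
              primitive volume u ((2 * L * r) ^ n)) := by
            rw [pow_rpow_inv hn (by positivity), ENNReal.ofReal_mul hC₄.le, mul_assoc,
              ENNReal.ofReal]
        _ ≤ C₄.toNNReal * T := by
            gcongr
            exact mul_primitive_le_supStarStar Φ f t hτ
        _ ≤ _ := by
            rw [add_mul]
            exact le_add_left le_self_add
  refine (rearrangement₂_le_of_le_add (Measurable.aemeasurable (by fun_prop)) hmax ht).trans ?_
  rw [lintegral_lintegral_mul_norm_sub hg hk]
  have hgoal : ((C₃ * C₂ + (C₄.toNNReal + (ω * C₁).toNNReal * C₂) : ℝ≥0) : ℝ≥0∞) * T =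
      C₃ * C₂ * T + (C₄.toNNReal + (ω * C₁).toNNReal * C₂) * T := by
    push_cast
    rw [add_mul]
  rw [hgoal]
  refine add_le_add ?_ le_rfl
  calc (ENNReal.ofReal t)⁻¹ * ((∫⁻ y, A.indicator u y) * ∫⁻ z : Rn n, k ‖z‖)
      ≤ (ENNReal.ofReal t)⁻¹ * (primitive volume u t * (C₃ * ENNReal.ofReal (Φ R * t))) := by
        gcongr
        · rw [lintegral_indicator hA]
          exact setLIntegral_le_lintegral_rearrangement hu.aemeasurable hAt
        · rw [← hRn]
          exact h₃ R hR
    _ = ((ENNReal.ofReal t)⁻¹ * ENNReal.ofReal t) * (C₃ *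
          (ENNReal.ofReal (Φ R) * primitive volume u t)) := by
        rw [ENNReal.ofReal_mul' ht.le]
        ring
    _ ≤ _ := by
        rw [ENNReal.inv_mul_cancel (by simpa using ht) ENNReal.ofReal_ne_top, one_mul, mul_assoc]
        gcongr

end Estimates

/-! ### Elements of `E`: finiteness, radial rearrangement, summation -/

section FunctionSpace

variable {n : ℕ} {E : FunctionalNorm (volume : Measure (Rn n))} {Φ : ℝ → ℝ}

lemma FunctionalNorm.norm_const_mul (E : FunctionalNorm (volume : Measure (Rn n))) {f : Rn n → ℂ}
    (hf : AEMeasurable f) (c : ℝ≥0) :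
    E.norm (fun x => ((c : ℝ) : ℂ) * f x) = c * E.norm f := by
  rw [norm, norm, ← E.smul c _ hf.nnnorm]
  congr 1
  ext x
  simp

lemma FunctionalNorm.const_mul_mem {f : Rn n → ℂ} (hf : f ∈ E.space) (c : ℝ≥0) :
    (fun x => ((c : ℝ) : ℂ) * f x) ∈ E.space := by
  refine ⟨hf.1.const_mul _, ?_⟩
  rw [E.norm_const_mul hf.1]
  exact ENNReal.mul_lt_top ENNReal.coe_lt_top hf.2

lemma supStarStar_const_mul (Φ : ℝ → ℝ) (f : Rn n → ℂ) (c : ℝ≥0) (t : Rpos) :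
    supStarStar Φ (fun x => ((c : ℝ) : ℂ) * f x) t = c * supStarStar Φ f t := by
  have h : (fun x => ‖((c : ℝ) : ℂ) * f x‖ₑ) = fun x => (c : ℝ≥0∞) * ‖f x‖ₑ := by
    ext x
    rw [enorm_mul]
    congr 1
    simp [enorm_eq_nnnorm]
  simp_rw [supStarStar, h, starStar, rearrangement₂_const_mul, ENNReal.mul_iSup, mul_left_comm]

lemma FunctionalNorm.zero_mem (E : FunctionalNorm (volume : Measure (Rn n))) :
    (0 : Rn n → ℂ) ∈ E.space ∧ E.norm 0 = 0 := by
  have h : E.norm 0 = 0 := by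
    rw [norm, E.eq_zero_iff _ (by simp)]
    exact .of_forall fun x => by simp
  exact ⟨⟨aemeasurable_const, by simp [h]⟩, h⟩

lemma exists_volume_ball_eq (hn : 1 ≤ n) {t : ℝ} (ht : 0 < t) :
    ∃ r : ℝ, 0 < r ∧ unitBallVolume n * r ^ n = t ∧
      volume (Metric.ball (0 : Rn n) r) = ENNReal.ofReal t := by
  have hω := unitBallVolume_pos n
  have h : unitBallVolume n * ((t / unitBallVolume n) ^ (1 / (n : ℝ))) ^ n = t := by
    rw [rpow_inv_pow hn (by positivity), mul_div_cancel₀ _ hω.ne']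
  exact ⟨_, by positivity, h, by rw [volume_ball_eq _ (by positivity), h]⟩

/-- If `f*(t) > y`, then `y χ_B` with `|B| = t` has smaller rearrangement than `f`, so `y ≤ ‖f‖ /
‖χ_B‖`. -/
lemma rearrangement_lt_top (hn : 1 ≤ n) (hE : E.RearrangementInvariant) {f : Rn n → ℂ}
    (hf : f ∈ E.space) {t : ℝ} (ht : 0 < t) : rearrangement volume (fun x => ‖f x‖ₑ) t < ∞ := by
  obtain ⟨r, hr, -, hvol⟩ := exists_volume_ball_eq hn ht
  set B := Metric.ball (0 : Rn n) r
  have hBm : MeasurableSet B := Metric.isOpen_ball.measurableSet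
  have h0 : 0 < volume B := Metric.measure_ball_pos _ _ hr
  set χ : Rn n → ℝ≥0 := B.indicator fun _ => 1
  have hχm : AEMeasurable χ := (measurable_const.indicator hBm).aemeasurable
  have hχ : E.toFun χ ≠ 0 := by
    rw [Ne, E.eq_zero_iff _ hχm]
    intro h
    refine h0.ne' (measure_mono_null (fun x hx => ?_) h)
    simpa [χ] using hx
  have key : ∀ y : ℝ≥0, (y : ℝ≥0∞) < rearrangement volume (fun x => ‖f x‖ₑ) t →
      (y : ℝ≥0∞) ≤ E.norm f / E.toFun χ := by
    intro y hy
    rw [ENNReal.le_div_iff_mul_le (.inl hχ) (.inr hf.2.ne), ← E.smul y _ hχm]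
    refine hE _ _ (hχm.const_mul y) hf.1.nnnorm fun s _ => ?_
    refine rearrangement_le_of_distribution_le (fun z => ?_) s
    rcases lt_or_ge z y with hz | hz
    · calc distribution volume (fun x => ((y * χ x : ℝ≥0) : ℝ≥0∞)) z ≤ volume B := by
            refine measure_mono fun x hx => ?_
            by_contra hxB
            simp [χ, indicator_of_notMem hxB] at hx
        _ = ENNReal.ofReal t := hvol
        _ ≤ _ := (lt_rearrangement_iff.1 hy).le.trans (distribution_antitone _ hz.le)
    · refine le_of_eq_of_le (measure_mono_null (t := ∅) (fun x hx => ?_) measure_empty) zero_le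
      refine absurd hx (not_lt.2 (le_trans ?_ hz))
      rw [ENNReal.coe_le_coe]
      exact mul_le_of_le_one_right' (indicator_le_self' (fun _ _ => zero_le) x)
  refine lt_of_le_of_lt (le_of_forall_lt_imp_le_of_dense fun y hy => ?_)
    (ENNReal.div_lt_top hf.2.ne hχ)
  lift y to ℝ≥0 using hy.ne_top
  exact key y hy

/-- The radial function `x ↦ f*(ω ‖x‖ⁿ)`, with `ω` the volume of the unit ball. -/
noncomputable def radialRearrangement (f : Rn n → ℂ) (x : Rn n) : ℂ :=
  ((rearrangement volume (fun y => ‖f y‖ₑ) (unitBallVolume n * ‖x‖ ^ n)).toReal : ℂ)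

lemma enorm_radialRearrangement_le (f : Rn n → ℂ) (x : Rn n) :
    ‖radialRearrangement f x‖ₑ ≤
      rearrangement volume (fun y => ‖f y‖ₑ) (unitBallVolume n * ‖x‖ ^ n) := by
  rw [radialRearrangement, ← ofReal_norm, Complex.norm_real,
    Real.norm_of_nonneg ENNReal.toReal_nonneg]
  exact ENNReal.ofReal_toReal_le

/-- Only the origin is exceptional: there `f*(0)` may be infinite and `toReal` turns it into `0`. -/
lemma enorm_radialRearrangement_ae (hn : 1 ≤ n) (hE : E.RearrangementInvariant) {f : Rn n → ℂ}
    (hf : f ∈ E.space) : ∀ᵐ x : Rn n, ‖radialRearrangement f x‖ₑ =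
      rearrangement volume (fun y => ‖f y‖ₑ) (unitBallVolume n * ‖x‖ ^ n) := by
  have : Nonempty (Fin n) := ⟨⟨0, hn⟩⟩
  filter_upwards [Measure.ae_ne volume (0 : Rn n)] with x hx
  have hω := unitBallVolume_pos n
  have hx' : 0 < ‖x‖ := norm_pos_iff.2 hx
  rw [radialRearrangement, ← ofReal_norm, Complex.norm_real,
    Real.norm_of_nonneg ENNReal.toReal_nonneg]
  exact ENNReal.ofReal_toReal (rearrangement_lt_top hn hE hf (by positivity)).ne

lemma radialRearrangement_mem (hn : 1 ≤ n) (hE : E.RearrangementInvariant) {f : Rn n → ℂ}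
    (hf : f ∈ E.space) :
    radialRearrangement f ∈ E.space ∧ E.norm (radialRearrangement f) ≤ E.norm f := by
  have hm : AEMeasurable (radialRearrangement f) :=
    (Complex.measurable_ofReal.comp (ENNReal.measurable_toReal.comp
      (measurable_radial (rearrangement_antitone _)))).aemeasurable
  have h : E.norm (radialRearrangement f) ≤ E.norm f := by
    refine hE _ _ hm.nnnorm hf.1.nnnorm fun t _ =>
      rearrangement_le_of_distribution_le (fun y => ?_) t
    refine (distribution_mono (.of_forall (enorm_radialRearrangement_le f)) y).trans_eq ?_
    exact distribution_radial hn _ y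
  exact ⟨⟨hm, h.trans_lt hf.2⟩, h⟩

lemma setLIntegral_ball_radialRearrangement (hn : 1 ≤ n) (hE : E.RearrangementInvariant)
    {f : Rn n → ℂ} (hf : f ∈ E.space) {r : ℝ} (hr : 0 < r) :
    ∫⁻ x in Metric.ball (0 : Rn n) r, ‖radialRearrangement f x‖ₑ =
      primitive volume (fun x => ‖f x‖ₑ) (unitBallVolume n * r ^ n) := by
  rw [← setLIntegral_ball_radial hn _ hr]
  exact lintegral_congr_ae (ae_restrict_of_ae (enorm_radialRearrangement_ae hn hE hf))

lemma setLIntegral_ball_lt_top {f : Rn n → ℂ} (hf : f ∈ E.space) {r : ℝ} (hr : 0 < r) :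
    ∫⁻ x in Metric.ball (0 : Rn n) r, ‖f x‖ₑ < ∞ := by
  obtain ⟨c, hc⟩ := E.lintegral_le (Metric.ball 0 r) Metric.isOpen_ball.measurableSet
    (Metric.measure_ball_pos _ _ hr) measure_ball_lt_top
  exact (hc _ hf.1.nnnorm).trans_lt (ENNReal.mul_lt_top ENNReal.coe_lt_top hf.2)

lemma primitive_lt_top (hn : 1 ≤ n) (hE : E.RearrangementInvariant)
    {f : Rn n → ℂ} (hf : f ∈ E.space) {t : ℝ} (ht : 0 < t) :
    primitive volume (fun x => ‖f x‖ₑ) t < ∞ := by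
  obtain ⟨r, hr, hrt, -⟩ := exists_volume_ball_eq hn ht
  rw [← hrt, ← setLIntegral_ball_radialRearrangement hn hE hf hr]
  exact setLIntegral_ball_lt_top (radialRearrangement_mem hn hE hf).1 hr

lemma supStarStar_antitone (Φ : ℝ → ℝ) (f : Rn n → ℂ) : Antitone (supStarStar Φ f) :=
  fun _ _ h => iSup₂_le fun τ hτ => le_iSup₂_of_le τ (h.trans_lt hτ) le_rfl

/-- Values `τ ≤ t` contribute at most `Φ(t₀^(1/n)) ∫₀ᵗ f* < ∞`, so an infinite supremum must come
from `τ > t`. -/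
lemma supStarStar_eq_top (hn : 1 ≤ n) (hB : ClassB n Φ) (hE : E.RearrangementInvariant)
    {f : Rn n → ℂ} (hf : f ∈ E.space) {t₀ : Rpos} (h : supStarStar Φ f t₀ = ∞) (t : Rpos) :
    supStarStar Φ f t = ∞ := by
  by_contra hne
  have ht : (0 : ℝ) < t := t.2
  have ht₀ : (0 : ℝ) < t₀ := t₀.2
  refine (lt_of_le_of_lt ?_ (max_lt (ENNReal.mul_lt_top
    (ENNReal.ofReal_lt_top (r := Φ ((t₀ : ℝ) ^ (1 / (n : ℝ))))) (primitive_lt_top hn hE hf ht))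
    (lt_top_iff_ne_top.2 hne))).ne h
  conv_lhs => rw [supStarStar_eq]
  refine iSup₂_le fun τ hτ => ?_
  rcases le_or_gt τ t with hτt | hτt
  · refine le_max_of_le_left ?_
    have hτ0 : (0 : ℝ) < τ := τ.2
    gcongr
    · refine hB.antitoneOn (mem_Ioi.2 (by positivity)) (mem_Ioi.2 (by positivity)) ?_
      have : (t₀ : ℝ) ≤ τ := hτ.le
      gcongr
    · exact primitive_mono_right _ _ hτt
  · exact le_max_of_le_right (mul_primitive_le_supStarStar Φ f t hτt)

/-- Take the centred ball of volume `τ` and radius `R`. Around each of its points the ball of radius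
`2R` contains it, so `M_Φ g ≥ Φ(2R) ∫₀^τ f*` on a set of measure `τ > t`. -/
lemma exists_supStarStar_le_star (hn : 1 ≤ n) (hB : ClassB n Φ) (hE : E.RearrangementInvariant) :
    ∃ C : ℝ≥0, ∀ f ∈ E.space, ∀ t : Rpos,
      supStarStar Φ f t ≤ C * star (maximal Φ (radialRearrangement f)) t := by
  set ω := unitBallVolume n
  have hω : 0 < ω := unitBallVolume_pos n
  set b : ℝ := (1 / ω) ^ (1 / (n : ℝ))
  have hb : 0 < b := by positivity
  obtain ⟨C, hC, h⟩ := hB.exists_le_mul hn (le_max_left 1 (2 * b))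
  refine ⟨C.toNNReal, fun f hf t => ?_⟩
  rw [supStarStar_eq]
  refine iSup₂_le fun τ hτ => ?_
  have ht : (0 : ℝ) < t := t.2
  have hτ0 : (0 : ℝ) < τ := τ.2
  set R : ℝ := b * (τ : ℝ) ^ (1 / (n : ℝ))
  have hR : 0 < R := by positivity
  have hRτ : ω * R ^ n = τ := by
    rw [mul_pow, rpow_inv_pow hn hτ0.le, rpow_inv_pow hn (by positivity)]
    field_simp
  set v := ENNReal.ofReal (Φ (2 * R)) * primitive volume (fun x => ‖f x‖ₑ) τ
  have hball : ∀ x ∈ Metric.ball (0 : Rn n) R, v ≤ maximal Φ (radialRearrangement f) x := by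
    intro x hx
    refine le_iSup₂_of_le (2 * R) (by positivity) (mul_le_mul_right ?_ _)
    rw [← hRτ, ← setLIntegral_ball_radialRearrangement hn hE hf hR]
    refine lintegral_mono_set fun y hy => ?_
    rw [mem_ball_zero_iff] at hx hy
    rw [mem_ball_iff_norm]
    linarith [norm_sub_le y x]
  have hstar : v ≤ star (maximal Φ (radialRearrangement f)) t := by
    refine le_of_forall_lt fun y hy => lt_rearrangement_iff.2 ?_
    calc ENNReal.ofReal t < ENNReal.ofReal τ := (ENNReal.ofReal_lt_ofReal_iff hτ0).2 hτ
      _ = volume (Metric.ball (0 : Rn n) R) := by rw [volume_ball_eq _ hR, hRτ]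
      _ ≤ _ := measure_mono fun x hx => hy.trans_le (hball x hx)
  calc ENNReal.ofReal (Φ ((τ : ℝ) ^ (1 / (n : ℝ)))) * primitive volume (fun x => ‖f x‖ₑ) τ
      ≤ ENNReal.ofReal (C * Φ (2 * R)) * primitive volume (fun x => ‖f x‖ₑ) τ := by
        gcongr
        refine (h _ (by positivity)).trans ?_
        gcongr
        refine hB.antitoneOn (mem_Ioi.2 (by positivity)) (mem_Ioi.2 (by positivity)) ?_
        rw [← mul_assoc]
        gcongr
        exact le_max_right _ _
    _ = C.toNNReal * v := by rw [ENNReal.ofReal_mul hC.le, mul_assoc, ENNReal.ofReal]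
    _ ≤ _ := by gcongr

/-- An absolutely summable series in `E` has a sum in `E` dominating each of its terms. -/
lemma exists_dominating {f : ℕ → Rn n → ℂ} (hf : ∀ k, AEMeasurable (f k))
    (h : ∑' k, E.norm (f k) < ∞) :
    ∃ g ∈ E.space, ∀ k, ∀ᵐ x, ‖f k x‖ₑ ≤ ‖g x‖ₑ := by
  set S : ℕ → Rn n → ℝ≥0 := fun N x => ∑ k ∈ Finset.range N, ‖f k x‖₊
  have hS (N : ℕ) : AEMeasurable (S N) := by
    have := Finset.aemeasurable_fun_sum (Finset.range N) fun k _ => (hf k).nnnorm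
    exact this
  have hSnorm (N : ℕ) : E.toFun (S N) ≤ ∑' k, E.norm (f k) := by
    refine le_trans ?_ (ENNReal.sum_le_tsum (Finset.range N))
    induction N with
    | zero =>
      have : E.toFun (S 0) = 0 := by
        rw [E.eq_zero_iff _ (hS 0)]
        exact .of_forall fun x => by simp [S]
      simp [this]
    | succ N ih =>
      rw [Finset.sum_range_succ]
      have : S (N + 1) = fun x => S N x + ‖f N x‖₊ := by
        ext x
        simp [S, Finset.sum_range_succ]
      rw [this]
      exact (E.add_le _ _ (hS N) (hf N).nnnorm).trans (by gcongr; exact le_rfl)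
  set s : Rn n → ℝ≥0∞ := fun x => ∑' k, ‖f k x‖ₑ
  have hs : AEMeasurable s := AEMeasurable.tsum fun k => (hf k).enorm
  have hsS (x : Rn n) : s x = ⨆ N, (S N x : ℝ≥0∞) := by
    simp only [s, S, ENNReal.tsum_eq_iSup_nat, ENNReal.ofNNReal_finsetSum]
    rfl
  have hmono : ∀ x, Monotone fun N => S N x := fun x i j hij =>
    Finset.sum_le_sum_of_subset (Finset.range_mono hij)
  -- Local integrability (P4) bounds the integrals of the partial sums over each ball; monotone
  -- convergence passes to `s`.
  have hfin : ∀ᵐ x, s x < ∞ := by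
    have hball : ∀ m : ℕ, ∀ᵐ x, x ∈ Metric.ball (0 : Rn n) (m + 1) → s x < ∞ := by
      intro m
      rw [← ae_restrict_iff' Metric.isOpen_ball.measurableSet]
      refine ae_lt_top' hs.restrict (ne_of_lt ?_)
      obtain ⟨c, hc⟩ := E.lintegral_le (Metric.ball 0 (m + 1)) Metric.isOpen_ball.measurableSet
        (Metric.measure_ball_pos _ _ (by positivity)) measure_ball_lt_top
      simp_rw [hsS]
      rw [lintegral_iSup' (fun N => ((hS N).coe_nnreal_ennreal).restrict)
        (.of_forall fun x i j hij => ENNReal.coe_le_coe.2 (hmono x hij))]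
      refine lt_of_le_of_lt (iSup_le fun N => (hc _ (hS N)).trans ?_)
        (ENNReal.mul_lt_top (ENNReal.coe_lt_top (r := c)) h)
      gcongr
      exact hSnorm N
    rw [← ae_all_iff] at hball
    filter_upwards [hball] with x hx
    obtain ⟨m, hm⟩ := exists_nat_gt ‖x‖
    exact hx m (mem_ball_zero_iff.2 (by linarith))
  have hgn : ∀ x, ‖(((s x).toNNReal : ℝ) : ℂ)‖₊ = (s x).toNNReal := fun x => by simp
  refine ⟨fun x => (((s x).toNNReal : ℝ) : ℂ), ⟨?_, ?_⟩, fun k => ?_⟩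
  · exact Complex.measurable_ofReal.comp_aemeasurable
      (measurable_coe_nnreal_real.comp_aemeasurable hs.ennreal_toNNReal)
  · rw [FunctionalNorm.norm]
    simp_rw [hgn]
    refine lt_of_le_of_lt (le_of_tendsto' (E.fatou S _ hS hs.ennreal_toNNReal ?_) hSnorm) h
    filter_upwards [hfin] with x hx
    refine ⟨hmono x, ?_⟩
    rw [← ENNReal.tendsto_coe, ENNReal.coe_toNNReal hx.ne, hsS]
    exact tendsto_atTop_iSup fun i j hij => ENNReal.coe_le_coe.2 (hmono x hij)
  · filter_upwards [hfin] with x hx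
    rw [enorm_eq_nnnorm (((s x).toNNReal : ℝ) : ℂ), hgn, ENNReal.coe_toNNReal hx.ne]
    exact ENNReal.le_tsum k

end FunctionSpace

/-! ### Cones as images of `E`, and the covering argument -/

section Cones

variable {n : ℕ} {E : FunctionalNorm (volume : Measure (Rn n))} {Φ : ℝ → ℝ}

/-- `K` is the image of `E` under `T`, with the quotient functional of the norm of `E`. -/
structure Cone.IsImage (K : Cone) (E : FunctionalNorm (volume : Measure (Rn n)))
    (T : (Rn n → ℂ) → Rpos → ℝ≥0∞) : Prop where
  carrier_eq : K.carrier = T '' E.space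
  gauge_lt_iff : ∀ h c, K.gauge h < c ↔ ∃ f ∈ E.space, T f = h ∧ E.norm f < c

lemma Cone.IsImage.gauge_le {K : Cone} {T : (Rn n → ℂ) → Rpos → ℝ≥0∞} (hK : K.IsImage E T)
    {f : Rn n → ℂ} (hf : f ∈ E.space) : K.gauge (T f) ≤ E.norm f :=
  le_of_forall_gt fun c hc => (hK.gauge_lt_iff _ c).2 ⟨f, hf, rfl, hc⟩

lemma isImage_K₁ (Φ : ℝ → ℝ) (E : FunctionalNorm (volume : Measure (Rn n))) :
    (K₁ Φ E).IsImage E fun f => star (maximal Φ f) where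
  carrier_eq := by
    ext h
    constructor
    · rintro ⟨-, _, ⟨f, hf, rfl⟩, rfl⟩
      exact ⟨f, hf, rfl⟩
    · rintro ⟨f, hf, rfl⟩
      exact ⟨(rearrangement_antitone _).measurable.comp measurable_subtype_coe,
        _, ⟨f, hf, rfl⟩, rfl⟩
  gauge_lt_iff h c := by
    simp only [K₁, maximalNorm, iInf_lt_iff]
    constructor
    · rintro ⟨u, ⟨-, rfl⟩, f, ⟨hf, rfl⟩, hc⟩
      exact ⟨f, hf, rfl, hc⟩
    · rintro ⟨f, hf, rfl, hc⟩
      exact ⟨_, ⟨⟨f, hf, rfl⟩, rfl⟩, f, ⟨hf, rfl⟩, hc⟩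

lemma isImage_K₂ (Φ : ℝ → ℝ) (E : FunctionalNorm (volume : Measure (Rn n))) :
    (K₂ Φ E).IsImage E fun f => starStar (maximal Φ f) where
  carrier_eq := by
    ext h
    constructor
    · rintro ⟨_, ⟨f, hf, rfl⟩, rfl⟩
      exact ⟨f, hf, rfl⟩
    · rintro ⟨f, hf, rfl⟩
      exact ⟨_, ⟨f, hf, rfl⟩, rfl⟩
  gauge_lt_iff h c := by
    simp only [K₂, maximalNorm, iInf_lt_iff]
    constructor
    · rintro ⟨u, ⟨-, rfl⟩, f, ⟨hf, rfl⟩, hc⟩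
      exact ⟨f, hf, rfl, hc⟩
    · rintro ⟨f, hf, rfl, hc⟩
      exact ⟨_, ⟨⟨f, hf, rfl⟩, rfl⟩, f, ⟨hf, rfl⟩, hc⟩

lemma isImage_K₃ (Φ : ℝ → ℝ) (E : FunctionalNorm (volume : Measure (Rn n))) :
    (K₃ Φ E).IsImage E (supStarStar Φ) where
  carrier_eq := by
    ext h
    constructor
    · rintro ⟨-, f, hf, rfl⟩
      exact ⟨f, hf, rfl⟩
    · rintro ⟨f, hf, rfl⟩
      exact ⟨(supStarStar_antitone Φ f).measurable, f, hf, rfl⟩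
  gauge_lt_iff h c := by
    simp only [K₃, iInf_lt_iff, exists_prop, and_assoc]

lemma measurable_starStarAddSupStar (hB : ClassB n Φ) (f : Rn n → ℂ) :
    Measurable (starStarAddSupStar Φ f) := by
  have h₁ : Antitone fun t : Rpos => ENNReal.ofReal (Φ ((t : ℝ) ^ (1 / (n : ℝ)))) := by
    intro s t hst
    have hs : (0 : ℝ) < s := s.2
    have ht : (0 : ℝ) < t := t.2
    refine ENNReal.ofReal_le_ofReal (hB.antitoneOn (mem_Ioi.2 (by positivity))
      (mem_Ioi.2 (by positivity)) ?_)
    have : (s : ℝ) ≤ t := hst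
    gcongr
  have h₂ : Antitone fun t : Rpos => ⨆ (τ : Rpos) (_ : t < τ),
      ENNReal.ofReal (τ * Φ ((τ : ℝ) ^ (1 / (n : ℝ)))) * star (fun x => ‖f x‖ₑ) τ :=
    fun _ _ h => iSup₂_le fun τ hτ => le_iSup₂_of_le τ (h.trans_lt hτ) le_rfl
  unfold starStarAddSupStar
  simp_rw [ofReal_mul_starStar]
  exact (h₁.measurable.mul ((primitive_mono_right _ _).measurable.comp
    measurable_subtype_coe)).add h₂.measurable

lemma isImage_K₄ (hB : ClassB n Φ) (E : FunctionalNorm (volume : Measure (Rn n))) :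
    (K₄ Φ E).IsImage E (starStarAddSupStar Φ) where
  carrier_eq := by
    ext h
    constructor
    · rintro ⟨-, f, hf, rfl⟩
      exact ⟨f, hf, rfl⟩
    · rintro ⟨f, hf, rfl⟩
      exact ⟨measurable_starStarAddSupStar hB f, f, hf, rfl⟩
  gauge_lt_iff h c := by
    simp only [K₄, iInf_lt_iff, exists_prop, and_assoc]

/-- `T f` is bounded by a multiple of `supStarStar Φ f`. -/
def BoundedBySup (Φ : ℝ → ℝ) (E : FunctionalNorm (volume : Measure (Rn n)))
    (T : (Rn n → ℂ) → Rpos → ℝ≥0∞) : Prop :=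
  ∃ C : ℝ≥0, ∀ f ∈ E.space, ∀ t, T f t ≤ C * supStarStar Φ f t

/-- `supStarStar Φ f` is bounded by a multiple of `U g` for some `g` with `‖g‖_E ≤ ‖f‖_E`. -/
def DominatesSup (Φ : ℝ → ℝ) (E : FunctionalNorm (volume : Measure (Rn n)))
    (U : (Rn n → ℂ) → Rpos → ℝ≥0∞) : Prop :=
  ∃ C : ℝ≥0, ∀ f ∈ E.space, ∃ g ∈ E.space, E.norm g ≤ E.norm f ∧
    ∀ t, supStarStar Φ f t ≤ C * U g t

/-- The constant is absorbed by scaling `f`, since `supStarStar` is homogeneous; no homogeneity of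
`U` is needed. Using `C + 1` allows cancellation even if `C = 0`. -/
lemma DominatesSup.exists_le {U : (Rn n → ℂ) → Rpos → ℝ≥0∞} (hU : DominatesSup Φ E U) (B : ℝ≥0) :
    ∃ D : ℝ≥0, ∀ f ∈ E.space, ∃ g ∈ E.space, E.norm g ≤ D * E.norm f ∧
      ∀ t, B * supStarStar Φ f t ≤ U g t := by
  obtain ⟨C, hC⟩ := hU
  refine ⟨(C + 1) * B, fun f hf => ?_⟩
  obtain ⟨g, hg, hgf, h⟩ := hC _ (FunctionalNorm.const_mul_mem hf ((C + 1) * B))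
  rw [E.norm_const_mul hf.1] at hgf
  refine ⟨g, hg, hgf, fun t => ?_⟩
  have ht := h t
  rw [supStarStar_const_mul, ENNReal.coe_mul, mul_assoc] at ht
  have hC1 : C * U g t ≤ ((C + 1 : ℝ≥0) : ℝ≥0∞) * U g t := by
    gcongr
    exact le_self_add
  exact (ENNReal.mul_le_mul_iff_right (by simp) ENNReal.coe_ne_top).1 (ht.trans hC1)

/-- Arbitrarily small elements of `E` whose images under `supStarStar Φ` stay above a positive
bound at one point lead to an element of `E` whose image is identically `∞`. -/
lemma exists_supStarStar_eq_top (hn : 1 ≤ n) (hB : ClassB n Φ) (hE : E.RearrangementInvariant)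
    {t₀ : Rpos} {a : ℝ≥0∞} (ha : a ≠ 0)
    (h : ∀ ε : ℝ≥0∞, 0 < ε → ∃ f ∈ E.space, E.norm f < ε ∧ a ≤ supStarStar Φ f t₀) :
    ∃ g ∈ E.space, ∀ t, supStarStar Φ g t = ∞ := by
  obtain ⟨ε, hε, hsum⟩ := ENNReal.exists_pos_sum_of_countable' one_ne_zero ℕ
  -- Multiplying a sufficiently small element by `k` keeps its norm below `ε k` while its image at
  -- `t₀` reaches `k a`.
  have h' (k : ℕ) : ∃ f ∈ E.space, E.norm f ≤ ε k ∧ k * a ≤ supStarStar Φ f t₀ := by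
    obtain ⟨δ, hδ, hlt⟩ := ENNReal.exists_nnreal_pos_mul_lt (ENNReal.natCast_ne_top k) (hε k).ne'
    obtain ⟨f, hf, hfδ, hfa⟩ := h δ (by exact_mod_cast hδ)
    refine ⟨_, FunctionalNorm.const_mul_mem hf k, ?_, ?_⟩
    · rw [E.norm_const_mul hf.1]
      refine le_trans ?_ hlt.le
      rw [mul_comm, ENNReal.coe_natCast]
      gcongr
    · rw [supStarStar_const_mul, ENNReal.coe_natCast]
      gcongr
  choose f hf hfε hfa using h'
  obtain ⟨g, hg, hgf⟩ := exists_dominating (fun k => (hf k).1)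
    (((ENNReal.tsum_le_tsum hfε).trans_lt hsum).trans ENNReal.one_lt_top)
  refine ⟨g, hg, supStarStar_eq_top hn hB hE hg (t₀ := t₀) ?_⟩
  by_contra hne
  obtain ⟨k, hk⟩ := ENNReal.exists_nat_mul_gt ha hne
  exact (hk.trans_le ((hfa k).trans (supStarStar_mono Φ (hgf k) t₀))).false

lemma coveredBy (hn : 1 ≤ n) (hB : ClassB n Φ) (hE : E.RearrangementInvariant) {M K : Cone}
    {T U : (Rn n → ℂ) → Rpos → ℝ≥0∞} (hM : M.IsImage E T) (hK : K.IsImage E U)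
    (hT : BoundedBySup Φ E T) (hU : DominatesSup Φ E U) : M.CoveredBy K := by
  obtain ⟨B, hTB⟩ := hT
  obtain ⟨D, hD⟩ := hU.exists_le B
  refine ⟨D * 2 + 1, by positivity, fun h₁ hh₁ => ?_⟩
  rw [hM.carrier_eq] at hh₁
  obtain ⟨f₀, hf₀, rfl⟩ := hh₁
  have hfin : M.gauge (T f₀) < ∞ := (hM.gauge_le hf₀).trans_lt hf₀.2
  rcases eq_or_ne (M.gauge (T f₀)) 0 with h0 | h0
  · by_cases hz : ∀ t, T f₀ t = 0
    · obtain ⟨g, hg, hg0, -⟩ := hD 0 E.zero_mem.1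
      rw [E.zero_mem.2, mul_zero] at hg0
      refine ⟨U g, hK.carrier_eq ▸ mem_image_of_mem U hg, ?_, fun t => by simp [hz]⟩
      exact ((hK.gauge_le hg).trans hg0).trans zero_le
    · push Not at hz
      obtain ⟨t₀, ht₀⟩ := hz
      obtain ⟨g, hg, hgtop⟩ := exists_supStarStar_eq_top hn hB hE (t₀ := t₀)
        (ENNReal.div_ne_zero.2 ⟨ht₀, ENNReal.coe_ne_top (r := B)⟩) fun ε hε => by
          obtain ⟨f, hf, hfT, hfε⟩ := (hM.gauge_lt_iff _ ε).1 (h0 ▸ hε)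
          refine ⟨f, hf, hfε, ENNReal.div_le_of_le_mul' ?_⟩
          rw [← hfT]
          exact hTB f hf t₀
      obtain ⟨D', hD'⟩ := hU.exists_le 1
      -- Every multiple `δ g` still has image `∞` under `supStarStar`, so the constant `∞` has
      -- preimages under `U` of arbitrarily small norm.
      have hK' (δ : ℝ≥0) (hδ : 0 < δ) : ∃ g' ∈ E.space, U g' = (fun _ => ∞) ∧
          E.norm g' ≤ δ * (D' * E.norm g) := by
        obtain ⟨g', hg', hle, htop⟩ := hD' _ (FunctionalNorm.const_mul_mem hg δ)
        refine ⟨g', hg', funext fun t => top_unique ?_, ?_⟩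
        · refine le_trans (le_of_eq ?_) (htop t)
          rw [supStarStar_const_mul, hgtop, ENNReal.coe_one, one_mul,
            ENNReal.mul_top (by exact_mod_cast hδ.ne')]
        · rwa [E.norm_const_mul hg.1, mul_left_comm] at hle
      obtain ⟨g₁, hg₁, hU₁, -⟩ := hK' 1 one_pos
      refine ⟨fun _ => ∞, ?_, ?_, fun t => le_top⟩
      · rw [hK.carrier_eq, ← hU₁]
        exact mem_image_of_mem U hg₁
      · refine le_trans (le_of_not_gt fun hpos => ?_) (zero_le (a := _))
        obtain ⟨δ, hδ, hlt⟩ := ENNReal.exists_nnreal_pos_mul_lt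
          (ENNReal.mul_lt_top (ENNReal.coe_lt_top (r := D')) hg.2).ne hpos.ne'
        obtain ⟨g', hg', hU', hle⟩ := hK' δ hδ
        have := hK.gauge_le hg'
        rw [hU'] at this
        exact (hlt.trans_le (this.trans hle)).false
  -- A positive finite infimum is approximated within a factor 2, which is the 2 in the covering
  -- constant.
  · obtain ⟨f, hf, hfT, hfn⟩ := (hM.gauge_lt_iff (T f₀) (2 * M.gauge (T f₀))).1 (by
      rw [two_mul]
      exact ENNReal.lt_add_right hfin.ne h0)
    obtain ⟨g, hg, hgf, h⟩ := hD f hf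
    refine ⟨U g, hK.carrier_eq ▸ mem_image_of_mem U hg, ?_, fun t => ?_⟩
    · calc K.gauge (U g) ≤ D * E.norm f := (hK.gauge_le hg).trans hgf
        _ ≤ D * (2 * M.gauge (T f₀)) := by gcongr
        _ ≤ _ := by
          push_cast
          rw [← mul_assoc]
          gcongr
          exact le_self_add
    · rw [← hfT]
      exact (hTB f hf t).trans (h t)

end Cones

end FracMax

open FracMax in
theorem corollary3p1 (n : ℕ) (hn : 1 ≤ n) (Φ : ℝ → ℝ)
    (hB : FracMax.ClassB n Φ) (hD : FracMax.ClassD n Φ)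
    (E : FracMax.FunctionalNorm (MeasureTheory.volume : MeasureTheory.Measure (FracMax.Rn n)))
    (hE : E.RearrangementInvariant) :
    (FracMax.K₁ Φ E).Equivalent (FracMax.K₂ Φ E) ∧
    (FracMax.K₂ Φ E).Equivalent (FracMax.K₃ Φ E) ∧
    (FracMax.K₃ Φ E).Equivalent (FracMax.K₄ Φ E) := by
  have b₂ : BoundedBySup Φ E fun f => starStar (maximal Φ f) := by
    obtain ⟨C, h⟩ := hB.exists_starStar_maximal_le hn
    exact ⟨C, fun f hf t => h f hf.1 t⟩
  have b₁ : BoundedBySup Φ E fun f => star (maximal Φ f) := by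
    obtain ⟨C, h⟩ := b₂
    exact ⟨C, fun f hf t => (rearrangement_le_rearrangement₂ _ t.2).trans (h f hf t)⟩
  have b₃ : BoundedBySup Φ E (supStarStar Φ) := ⟨1, fun f _ t => by simp⟩
  have b₄ : BoundedBySup Φ E (starStarAddSupStar Φ) := by
    obtain ⟨C, h⟩ := hB.exists_starStarAddSupStar_le hn
    exact ⟨C, fun f _ t => h f t⟩
  have d₁ : DominatesSup Φ E fun f => star (maximal Φ f) := by
    obtain ⟨C, h⟩ := exists_supStarStar_le_star hn hB hE
    exact ⟨C, fun f hf => ⟨radialRearrangement f, (radialRearrangement_mem hn hE hf).1,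
      (radialRearrangement_mem hn hE hf).2, h f hf⟩⟩
  have d₂ : DominatesSup Φ E fun f => starStar (maximal Φ f) := by
    obtain ⟨C, h⟩ := d₁
    refine ⟨C, fun f hf => ?_⟩
    obtain ⟨g, hg, hgf, h⟩ := h f hf
    refine ⟨g, hg, hgf, fun t => (h t).trans ?_⟩
    gcongr
    exact rearrangement_le_rearrangement₂ _ t.2
  have d₃ : DominatesSup Φ E (supStarStar Φ) :=
    ⟨1, fun f hf => ⟨f, hf, le_rfl, fun t => by simp⟩⟩
  have d₄ : DominatesSup Φ E (starStarAddSupStar Φ) := by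
    obtain ⟨C, h⟩ := exists_supStarStar_le hn hB hD
    exact ⟨C, fun f hf => ⟨f, hf, le_rfl, h f⟩⟩
  have i₁ := isImage_K₁ Φ E
  have i₂ := isImage_K₂ Φ E
  have i₃ := isImage_K₃ Φ E
  have i₄ := isImage_K₄ hB E
  exact ⟨⟨coveredBy hn hB hE i₁ i₂ b₁ d₂, coveredBy hn hB hE i₂ i₁ b₂ d₁⟩,
    ⟨coveredBy hn hB hE i₂ i₃ b₂ d₃, coveredBy hn hB hE i₃ i₂ b₃ d₂⟩,
    ⟨coveredBy hn hB hE i₃ i₄ b₃ d₄, coveredBy hn hB hE i₄ i₃ b₄ d₃⟩⟩
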